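/- Let $m$ components $1,\dots,m$ be divided into non-empty groups $G_1,\dots,G_{n_G}$, and for each $g$ let $\mathcal C_{G_g}$ be a set of at most one pairwise constraint $i_c\to j_c$ with distinct $i_c,j_c\in G_g$. An order $\pi$ (a permutation of the components) is feasible if every component of $G_{g_1}$ precedes every component of $G_{g_2}$ whenever $g_1<g_2$, and $i_c$ precedes $j_c$ for every $i_c\to j_c$ in $\bigcup_g\mathcal C_{G_g}$. Put $I_{ij}(\pi)=1$ if $i$ precedes $j$ in $\pi$, and $-1$ otherwise. In the mixed-pairwise constrained ordering (MPWCO) model the expansion $x(\pi)$ consists of the constant $1$ and of all $I_{ij}(\pi)$, $i<j$, with $i,j$ in the same group and neither $i\to j$ nor $j\to i$ in that group's constraint set. A design measure $\xi$ is a probability measure on the feasible orders, and $M(\xi)=\sum_\pi\xi(\pi)x(\pi)x(\pi)^T$. It is $D$-optimal if it maximizes $\log\det M(\xi)$ (with $\log 0=-\infty$) and this maximum is finite; it is $G$-optimal if $M(\xi)$ is nonsingular and $\xi$ minimizes $\max_\pi x(\pi)^TM(\xi)^{-1}x(\pi)$ (maximum over feasible $\pi$) among all design measures with nonsingular moment matrix.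 An array whose rows are feasible orders has the design measure that gives each order the proportion of rows equal to it. Construct a design $D$ as follows. Below, $[A;B]$ stacks arrays, $(A\;\,B)$ juxtaposes them row by row, and $\sim C$ is $C$ with its columns reversed. An OofA-OA (order-of-addition orthogonal array) of strength 2 on $S$ is a non-empty array of orders of $S$ in which any (at most) two factors $I_{ij}$, $i<j$ in $S$, take each combination of signs with the same relative frequency as in the array of all $|S|!$ orders. (1) If $\mathcal C_{G_g}=\emptyset$: choose $k<|G_g|$, OofA-OAs $A,\bar A$ of strength 2 with the same number of runs on $k$ and $|G_g|-k$ components, and $b\ge1$ subsets (blocks) $o_1,\dots,o_b$ of $G_g$ of size $k$ with $\lambda_{ih}-\lambda_{jh}=(r_i-r_j)/2$ for all distinct $i,j,h\in G_g$, where $r_i$ is the number of blocks containing $i$ and $\lambda_{ij}$ the number of blocks containing $i$ and $j$. With $B_l$ and $C_l$ obtained from $A$ and $\bar A$ by relabelling with the symbols of $o_l$ and $G_g\setminus o_l$, let $D^{(l)}=[(B_l\;\,C_l);(\sim C_l\;\,B_l)]$ and $D_g=[D^{(1)};\dots;D^{(b)}]$. Alternatively, $D_g$ may be any OofA-OA of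 strength 2 on $G_g$. (2) If $\mathcal C_{G_g}=\{i_c\to j_c\}$ and $q=|G_g|$ is even: let $o_1,\dots,o_b$ be all $q/2$-subsets of $G_g$ that contain $i_c$. For each $l$ let the rows of $C_l$ be all orders of $G_g\setminus o_l$, each once. If $j_c\notin o_l$, let the rows of $B_l$ be all orders of $o_l$, each once, and put $D_l=[(B_l\;\,C_l);(B_l\;\sim C_l)]$. If $j_c\in o_l$, let $B_l=[B_l^c;B_l^c]$, where the rows of $B^c_l$ are all orders of $o_l$ in which $i_c$ precedes $j_c$, each once, and put $D_l=[(B_l\;\,C_l);(\sim C_l\;\,B_l)]$. Let $D_g=[D_1;\dots;D_b]$. (3) If $\mathcal C_{G_g}=\{i_c\to j_c\}$ and $q=|G_g|$ is odd: choose any $i\in G_g\setminus\{i_c,j_c\}$, construct an array for the components $G_g\setminus\{i\}$ and the constraint $i_c\to j_c$ as in (2), and let $D_g$ be obtained by stacking the $q$ arrays that arise from it by inserting a column of $i$ at each of the $q$ possible positions. Finally let the rows of $D$ be all concatenations $(w_1,\dots,w_{n_G})$ with $w_g$ a row of $D_g$, counted with multiplicity. Then every row of $D$ is feasible, and the design measure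 of $D$ is $D$-optimal and $G$-optimal under the MPWCO model. -/

import Mathlib

/-! Orders of components are lists; an array is the list of its rows. -/

namespace OofA

section Arrays

variable {α : Type*} [LinearOrder α]

/-- The set of all orders (permutations) of the components in `S`. -/
def orders (S : Finset α) : Finset (List α) := ⟨S.val.lists, Multiset.lists_nodup_finset S⟩

/-- Component `i` precedes component `j` in the order `r`. -/
def Precedes (i j : α) (r : List α) : Prop := r.idxOf i < r.idxOf j

instance (i j : α) : DecidablePred (Precedes i j) :=
  fun r => inferInstanceAs (Decidable (r.idxOf i < r.idxOf j))

/-- The pairwise ordering (PWO) factor `I_{ij}`. -/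
def pwo (i j : α) (r : List α) : ℤ := if Precedes i j r then 1 else -1

/-- `L` lists every element of `S` exactly once (in some sequence). -/
def Enumerates {β : Type*} (L : List β) (S : Finset β) : Prop := (L : Multiset β) = S.val

/-- The array `(A  B)`: the `r`-th row of `A` followed by the `r`-th row of `B`. -/
def beside (A B : List (List α)) : List (List α) := List.zipWith (fun a b => a ++ b) A B

/-- The column reversal `∼A`. -/
def colReverse (A : List (List α)) : List (List α) := A.map List.reverse

/-- `A` is an order-of-addition orthogonal array of strength `t` for the components in `S`:
the PWO factors `c 0, …, c (t-1)` take every sign pattern `v` in `A` with the same relative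
frequency as in the array of all `|S|!` orders. The `c s` need not be distinct, so that the
condition also covers sets of fewer than `t` factors; if there are at least `t` factors this is
equivalent to the condition for `t` distinct ones. -/
def IsOofAOA (t : ℕ) (S : Finset α) (A : List (List α)) : Prop :=
  A ≠ [] ∧ (∀ r ∈ A, r ∈ orders S) ∧
    ∀ c : Fin t → α × α, (∀ s, (c s).1 ∈ S ∧ (c s).2 ∈ S ∧ (c s).1 < (c s).2) →
      ∀ v : Fin t → ℤ,
        A.countP (fun r => decide (∀ s, pwo (c s).1 (c s).2 r = v s)) * (orders S).card =
          A.length * ((orders S).filter (fun r => ∀ s, pwo (c s).1 (c s).2 r = v s)).card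

/-- The number `r_i` of blocks that contain `i`. -/
def replication {b : ℕ} (o : Fin b → Finset α) (i : α) : ℕ :=
  (Finset.univ.filter (fun l => i ∈ o l)).card

/-- The number `λ_{ij}` of blocks that contain `i` and `j`. -/
def concurrence {b : ℕ} (o : Fin b → Finset α) (i j : α) : ℕ :=
  (Finset.univ.filter (fun l => i ∈ o l ∧ j ∈ o l)).card

/-- `o` is a block design with symbols `G` and `b` blocks of size `k` such that
`λ_{ih} - λ_{jh} = (r_i - r_j) / 2` for all distinct `i, j, h`. -/
def IsBalancedBlockDesign (G : Finset α) (k : ℕ) {b : ℕ} (o : Fin b → Finset α) : Prop :=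
  0 < b ∧ (∀ l, o l ⊆ G ∧ (o l).card = k) ∧
    ∀ i ∈ G, ∀ j ∈ G, ∀ h ∈ G, i ≠ j → i ≠ h → j ≠ h →
      (concurrence o i h : ℚ) - concurrence o j h = ((replication o i : ℚ) - replication o j) / 2

/-- Output of the construction for a group `G` without constraint. `A` and `A'` are
order-of-addition orthogonal arrays with the same number of runs for `k < |G|` and
`k' = |G| - k` components, `o` is a balanced block design with symbols `G`. For each block,
`B_l` and `C_l` arise from `A` and `A'` by relabelling with the symbols in `o l` and `G \ o l`;
the arrays `[B_l, C_l; ∼C_l, B_l]` are stacked. -/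
def IsUnconstrainedBlockArray (G : Finset α) (D : List (List α)) : Prop :=
  ∃ (k k' b : ℕ) (A : List (List (Fin k))) (A' : List (List (Fin k')))
    (o : Fin b → Finset α) (f : Fin b → Fin k → α) (f' : Fin b → Fin k' → α),
    k < G.card ∧ k + k' = G.card ∧
    IsOofAOA 2 Finset.univ A ∧ IsOofAOA 2 Finset.univ A' ∧ A.length = A'.length ∧
    IsBalancedBlockDesign G k o ∧
    (∀ l, Finset.univ.image (f l) = o l) ∧ (∀ l, Finset.univ.image (f' l) = G \ o l) ∧
    D = (List.ofFn fun l =>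
      let B := A.map (List.map (f l))
      let C := A'.map (List.map (f' l))
      beside B C ++ beside (colReverse C) B).flatten

/-- Output of the construction for a group `G` of even size with the constraint `ic → jc`.
The blocks are all `|G|/2`-subsets of `G` that contain `ic`. -/
def IsEvenConstrainedArray (G : Finset α) (ic jc : α) (D : List (List α)) : Prop :=
  Even G.card ∧
  ∃ (o : List (Finset α)) (B C : Finset α → List (List α)),
    Enumerates o ((G.powersetCard (G.card / 2)).filter (fun s => ic ∈ s)) ∧
    (∀ s ∈ o, jc ∉ s → Enumerates (B s) (orders s)) ∧
    (∀ s ∈ o, jc ∈ s → ∃ Bc, Enumerates Bc ((orders s).filter (Precedes ic jc)) ∧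
      B s = Bc ++ Bc) ∧
    (∀ s ∈ o, Enumerates (C s) (orders (G \ s))) ∧
    D = (o.map fun s =>
      if jc ∈ s then beside (B s) (C s) ++ beside (colReverse (C s)) (B s)
      else beside (B s) (C s) ++ beside (B s) (colReverse (C s))).flatten

/-- Output of the construction for a group `G` of odd size with the constraint `ic → jc`: a
third component `i` is inserted at each of the `|G|` possible positions into all rows of an
array for `G \ {i}` with the constraint `ic → jc`. -/
def IsOddConstrainedArray (G : Finset α) (ic jc : α) (D : List (List α)) : Prop :=
  Odd G.card ∧
  ∃ i ∈ G, i ≠ ic ∧ i ≠ jc ∧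
    ∃ D₀, IsEvenConstrainedArray (G.erase i) ic jc D₀ ∧
      D = ((List.range G.card).map fun k => D₀.map fun r => r.insertIdx k i).flatten

end Arrays

/-- A mixed-pairwise constrained order-of-addition problem: `m` components are divided into `n`
non-empty groups `G_0 → G_1 → ⋯`, and `within g` is the set of pairwise constraints
`i → j`, coded as `(i, j)`, in the `g`-th group; it has at most one element. -/
structure MixedProblem (m n : ℕ) where
  groupOf : Fin m → Fin n
  groupOf_surjective : Function.Surjective groupOf
  within : Fin n → Finset (Fin m × Fin m)
  within_card_le_one : ∀ g, (within g).card ≤ 1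
  within_mem : ∀ g, ∀ p ∈ within g, groupOf p.1 = g ∧ groupOf p.2 = g ∧ p.1 ≠ p.2

namespace MixedProblem

variable {m n : ℕ} (P : MixedProblem m n)

/-- The `g`-th group. -/
def group (g : Fin n) : Finset (Fin m) := Finset.univ.filter (fun i => P.groupOf i = g)

/-- All pairwise constraints: those from the order of the groups and those within groups. -/
def constraints : Finset (Fin m × Fin m) :=
  Finset.univ.filter (fun p => P.groupOf p.1 < P.groupOf p.2) ∪ Finset.univ.biUnion P.within

/-- The feasible set of orders. -/
def feasible : Finset (List (Fin m)) :=
  (orders Finset.univ).filter (fun r => ∀ p ∈ P.constraints, Precedes p.1 p.2 r)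

/-- The pairs `i < j` whose PWO factor occurs in the mixed-pairwise constrained ordering model. -/
abbrev ModelPair : Type :=
  {p : Fin m × Fin m // p.1 < p.2 ∧ p ∉ P.constraints ∧ p.swap ∉ P.constraints}

/-- The model expansion `x(π)`; the index `none` is the constant term. -/
def expansion (r : List (Fin m)) : Option P.ModelPair → ℝ
  | none => 1
  | some p => (pwo p.1.1 p.1.2 r : ℝ)

/-- `ξ` is a design measure on the feasible set (its values elsewhere play no role). -/
def IsDesignMeasure (ξ : List (Fin m) → ℝ) : Prop :=
  (∀ r ∈ P.feasible, 0 ≤ ξ r) ∧ ∑ r ∈ P.feasible, ξ r = 1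

/-- The moment matrix `M(ξ) = ∑ ξ(π) x(π) x(π)ᵀ`. -/
noncomputable def moment (ξ : List (Fin m) → ℝ) :
    Matrix (Option P.ModelPair) (Option P.ModelPair) ℝ :=
  ∑ r ∈ P.feasible, ξ r • Matrix.vecMulVec (P.expansion r) (P.expansion r)

/-- `ξ` maximizes `log det M`, where `log 0 = -∞`; since moment matrices are positive
semidefinite this says that `ξ` maximizes `det M` and that the maximum is positive. -/
def IsDOptimal (ξ : List (Fin m) → ℝ) : Prop :=
  P.IsDesignMeasure ξ ∧ 0 < (P.moment ξ).det ∧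
    ∀ η, P.IsDesignMeasure η → (P.moment η).det ≤ (P.moment ξ).det

/-- The maximum of `x(π)ᵀ M(ξ)⁻¹ x(π)` over the (finite, non-empty) feasible set, for a design
measure with nonsingular moment matrix. -/
noncomputable def gValue (ξ : List (Fin m) → ℝ) : ℝ :=
  ⨆ r : P.feasible, P.expansion r ⬝ᵥ ((P.moment ξ)⁻¹.mulVec (P.expansion r))

/-- `ξ` has a nonsingular moment matrix and minimizes the `G`-value among all design measures
with nonsingular moment matrix. -/
def IsGOptimal (ξ : List (Fin m) → ℝ) : Prop :=
  P.IsDesignMeasure ξ ∧ (P.moment ξ).det ≠ 0 ∧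
    ∀ η, P.IsDesignMeasure η → (P.moment η).det ≠ 0 → P.gValue ξ ≤ P.gValue η

/-- `D` is an output of the construction for the problem `P`: an array `Dg g` is constructed for
every group, and the rows of `D` are all concatenations `(w_0, w_1, …)` with `w_g` a row of
`Dg g`, counted with multiplicity and stacked in any sequence. For a group without constraint,
an order-of-addition orthogonal array of strength 2 may also be used directly. -/
def IsConstructedCOD (D : List (List (Fin m))) : Prop :=
  ∃ Dg : Fin n → List (List (Fin m)),
    (∀ g, P.within g = ∅ →
      IsUnconstrainedBlockArray (P.group g) (Dg g) ∨ IsOofAOA 2 (P.group g) (Dg g)) ∧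
    (∀ g ic jc, P.within g = {(ic, jc)} →
      (Even (P.group g).card → IsEvenConstrainedArray (P.group g) ic jc (Dg g)) ∧
      (Odd (P.group g).card → IsOddConstrainedArray (P.group g) ic jc (Dg g))) ∧
    D.Perm ((List.ofFn Dg).sections.map List.flatten)

end MixedProblem

/-- The design measure of an array: the proportion of runs allocated to each order. -/
noncomputable def runProportion {m : ℕ} (D : List (List (Fin m))) (r : List (Fin m)) : ℝ :=
  (D.count r : ℝ) / D.length

end OofA

/-! Suppose that `x(π)ᵀ M(ξ)⁻¹ x(π)` has the same value `d` at every feasible `π`. Then `tr (M(ξ)⁻¹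
M(η)) = d` for every design measure `η`, and `η = ξ` shows that `d` is the number of parameters. The
inequality of arithmetic and geometric means for eigenvalues gives `det M(η) ≤ det M(ξ)`. For
nonsingular `M(η)`, the variance function of `η` has `η`-average `d`, so its maximum is at least
`d`. No inverse has to be computed: it suffices to solve `M(ξ) c = w` for every `w` and to evaluate
the solution for `w = x(π)` at `π` (`isDOptimal_and_isGOptimal_of_solution`).

What is needed of the array is that each `D_g` has the second moments of the signs in the set of all
orders of its group (`IsPairBalanced`). A constraint does not contradict this, because a product of
two signs is unchanged when the order is reversed. In a constrained group the constrained sign is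
identically 1, so it plays the role of the constant term and every first moment is a second moment;
in an unconstrained group the first moments vanish. Concatenation makes the groups independent.
These facts (`HasProductMoments`) determine the moment matrix.

Up to the factor 3, the uniform second moments are an inner product of differences of unit vectors
plus an inner product of antisymmetrized pairs (`pairCov`). Such an operator is inverted through its
row sums (`groupSolution_spec`). The resulting predictor depends on an order only through the sum of
squared row sums of its sign matrix, which is the same for all orders
(`three_mul_sum_sq_sum_ordSign`).

Balance of each `D_g` rests on the identity `ordSign_triple`, by which moments of factors that share
a component only have to be symmetric. For stacked blocks, what remains is a condition on how the
blocks separate components (`IsPairBalanced.flatten_of_blocks`). It follows from the block design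
equation, or from the symmetry of the family of all half-sized subsets. -/

/-! ### Optimality from a constant variance function. -/

open scoped MatrixOrder Matrix in
/-- If `M` is positive definite, `N` positive semidefinite and `tr (M⁻¹ N)` is at most the
dimension, then `det N ≤ det M`. -/
theorem Matrix.PosSemidef.det_le_det_of_trace_inv_mul_le {ι : Type*} [Fintype ι] [DecidableEq ι]
    {M N : Matrix ι ι ℝ} (hM : M.PosSemidef) (hN : N.PosSemidef) (hdet : M.det ≠ 0)
    (htr : (M⁻¹ * N).trace ≤ Fintype.card ι) : N.det ≤ M.det := by
  -- With `M = yᴴ y`, the congruent matrix `(y⁻¹)ᴴ N y⁻¹` is positive semidefinite, has the trace of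
  -- `M⁻¹ N`, and has determinant `det N / det M`.
  obtain ⟨y, rfl⟩ := CStarAlgebra.nonneg_iff_eq_star_mul_self.mp hM.nonneg
  rw [Matrix.star_eq_conjTranspose] at *
  have hdet' : (yᴴ * y).det = y.det * y.det := by simp [Matrix.det_mul]
  have hy : y.det ≠ 0 := fun h => hdet (by rw [hdet', h, zero_mul])
  have hK := hN.conjTranspose_mul_mul_same y⁻¹
  have htrK : ((y⁻¹)ᴴ * N * y⁻¹).trace ≤ Fintype.card ι := by
    rw [Matrix.trace_mul_comm, ← Matrix.mul_assoc, Matrix.conjTranspose_nonsing_inv,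
      ← Matrix.mul_inv_rev]
    exact htr
  have hdetK : ((y⁻¹)ᴴ * N * y⁻¹).det * (y.det * y.det) = N.det := by
    simp only [Matrix.det_mul, Matrix.det_conjTranspose, Matrix.det_nonsing_inv,
      Ring.inverse_eq_inv', star_trivial]
    field_simp
  have hle : ((y⁻¹)ᴴ * N * y⁻¹).det ≤ 1 := by
    rw [hK.isHermitian.det_eq_prod_eigenvalues]
    rw [hK.isHermitian.trace_eq_sum_eigenvalues] at htrK
    simp only [RCLike.ofReal_real_eq_id, id] at htrK ⊢
    -- The bound `t ≤ exp (t - 1)` turns the product into a sum and replaces the inequality of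
    -- means.
    calc ∏ i, hK.isHermitian.eigenvalues i
        ≤ ∏ i, Real.exp (hK.isHermitian.eigenvalues i - 1) := by
          refine Finset.prod_le_prod (fun i _ => hK.eigenvalues_nonneg i) fun i _ => ?_
          linarith [Real.add_one_le_exp (hK.isHermitian.eigenvalues i - 1)]
      _ = Real.exp (∑ i, (hK.isHermitian.eigenvalues i - 1)) := (Real.exp_sum _ _).symm
      _ ≤ 1 := by
          rw [Real.exp_le_one_iff, Finset.sum_sub_distrib]
          simpa using htrK
  rw [← hdetK, hdet']
  nlinarith [mul_self_nonneg y.det]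

namespace OofA

namespace MixedProblem

variable {m n : ℕ} (P : MixedProblem m n)

theorem posSemidef_moment {ξ : List (Fin m) → ℝ} (hξ : ∀ r ∈ P.feasible, 0 ≤ ξ r) :
    (P.moment ξ).PosSemidef := by
  refine Matrix.posSemidef_sum _ fun r hr => ?_
  exact (by simpa using Matrix.posSemidef_vecMulVec_self_star (P.expansion r) :
    (Matrix.vecMulVec (P.expansion r) (P.expansion r)).PosSemidef).smul (hξ r hr)

theorem trace_mul_moment (A : Matrix (Option P.ModelPair) (Option P.ModelPair) ℝ)
    (ξ : List (Fin m) → ℝ) :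
    (A * P.moment ξ).trace =
      ∑ r ∈ P.feasible, ξ r * (P.expansion r ⬝ᵥ A.mulVec (P.expansion r)) := by
  simp only [moment, Matrix.mul_sum, Matrix.trace_sum, Matrix.mul_smul, Matrix.trace_smul,
    Matrix.mul_vecMulVec, Matrix.trace_vecMulVec, smul_eq_mul]
  exact Finset.sum_congr rfl fun r _ => by rw [dotProduct_comm]

/-- This form makes the normal equations statements about functions of an order: the predictor with
coefficients `c` is integrated against each model function. -/
theorem moment_mulVec (ξ : List (Fin m) → ℝ) (c : Option P.ModelPair → ℝ)
    (k : Option P.ModelPair) :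
    (P.moment ξ).mulVec c k =
      ∑ r ∈ P.feasible, ξ r * (P.expansion r k * (P.expansion r ⬝ᵥ c)) := by
  simp only [moment, Matrix.sum_mulVec, Finset.sum_apply, Matrix.smul_mulVec,
    Matrix.vecMulVec_mulVec, Pi.smul_apply, smul_eq_mul, MulOpposite.smul_eq_mul_unop,
    MulOpposite.unop_op]

/-- A design measure with nonsingular moment matrix for which `x(π)ᵀ M⁻¹ x(π)` is the same for
all feasible `π` is `D`- and `G`-optimal. -/
theorem isDOptimal_and_isGOptimal_of_const {ξ : List (Fin m) → ℝ} (hξ : P.IsDesignMeasure ξ)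
    (hdet : (P.moment ξ).det ≠ 0) (d : ℝ)
    (hd : ∀ r ∈ P.feasible, P.expansion r ⬝ᵥ ((P.moment ξ)⁻¹.mulVec (P.expansion r)) = d) :
    P.IsDOptimal ξ ∧ P.IsGOptimal ξ := by
  have hM := P.posSemidef_moment hξ.1
  have htrace : ∀ η, P.IsDesignMeasure η → ((P.moment ξ)⁻¹ * P.moment η).trace = d := by
    intro η hη
    rw [trace_mul_moment, Finset.sum_congr rfl fun r hr => by rw [hd r hr], ← Finset.sum_mul,
      hη.2, one_mul]
  have hcard : d = Fintype.card (Option P.ModelPair) := by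
    rw [← htrace ξ hξ, Matrix.nonsing_inv_mul _ (isUnit_iff_ne_zero.mpr hdet), Matrix.trace_one]
  refine ⟨⟨hξ, (hM.posDef_iff_det_ne_zero.mpr hdet).det_pos, fun η hη => ?_⟩,
    hξ, hdet, fun η hη hη0 => ?_⟩
  · exact hM.det_le_det_of_trace_inv_mul_le (P.posSemidef_moment hη.1) hdet
      ((htrace η hη).trans hcard).le
  · have hne : P.feasible.Nonempty := by
      rw [Finset.nonempty_iff_ne_empty]
      intro h
      have := hξ.2
      simp [h] at this
    have : Nonempty P.feasible := hne.to_subtype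
    have hg : P.gValue ξ = d := by
      unfold gValue
      rw [iSup_congr fun r : P.feasible => hd r r.2, ciSup_const]
    have hle : ∀ r ∈ P.feasible,
        P.expansion r ⬝ᵥ ((P.moment η)⁻¹.mulVec (P.expansion r)) ≤ P.gValue η := fun r hr =>
      le_ciSup (f := fun r : P.feasible =>
        P.expansion r ⬝ᵥ ((P.moment η)⁻¹.mulVec (P.expansion r)))
        (Set.finite_range _).bddAbove ⟨r, hr⟩
    rw [hg, hcard]
    -- The number of parameters is the `η`-average of the variance function of `η`, hence at most
    -- its maximum.
    calc (Fintype.card (Option P.ModelPair) : ℝ) = ((P.moment η)⁻¹ * P.moment η).trace := by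
          rw [Matrix.nonsing_inv_mul _ (isUnit_iff_ne_zero.mpr hη0), Matrix.trace_one]
      _ ≤ ∑ r ∈ P.feasible, η r * P.gValue η := by
          rw [trace_mul_moment]
          exact Finset.sum_le_sum fun r hr => mul_le_mul_of_nonneg_left (hle r hr) (hη.1 r hr)
      _ = P.gValue η := by rw [← Finset.sum_mul, hη.2, one_mul]

/-- If for every right-hand side `w` a linear predictor solves the normal equations, and its value
at `π` for `w = x(π)` does not depend on `π`, then the design measure is optimal. -/
theorem isDOptimal_and_isGOptimal_of_solution {ξ : List (Fin m) → ℝ} (hξ : P.IsDesignMeasure ξ)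
    (c : (Option P.ModelPair → ℝ) → Option P.ModelPair → ℝ)
    (hc : ∀ w, (P.moment ξ).mulVec (c w) = w) (d : ℝ)
    (hd : ∀ r ∈ P.feasible, P.expansion r ⬝ᵥ c (P.expansion r) = d) :
    P.IsDOptimal ξ ∧ P.IsGOptimal ξ := by
  have hu : IsUnit (P.moment ξ) :=
    Matrix.mulVec_surjective_iff_isUnit.mp fun w => ⟨c w, hc w⟩
  have hu' := (Matrix.isUnit_iff_isUnit_det _).mp hu
  refine P.isDOptimal_and_isGOptimal_of_const hξ hu'.ne_zero d fun r hr => ?_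
  rw [← hd r hr]
  congr 1
  conv_lhs => rw [← hc (P.expansion r)]
  rw [Matrix.mulVec_mulVec, Matrix.nonsing_inv_mul _ hu', Matrix.one_mulVec]

end MixedProblem

end OofA

/-! ### Signs of pairs and their second moments. -/

namespace OofA

section PairMoments

variable {α β : Type*}

theorem mem_orders {S : Finset α} {r : List α} : r ∈ orders S ↔ (r : Multiset α) = S.val := by
  change r ∈ S.val.lists ↔ _
  rw [Multiset.mem_lists_iff, eq_comm]
  rfl

theorem nodup_of_mem_orders {S : Finset α} {r : List α} (h : r ∈ orders S) : r.Nodup := by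
  rw [← Multiset.coe_nodup, mem_orders.mp h]
  exact S.nodup

theorem mem_iff_of_mem_orders {S : Finset α} {r : List α} (h : r ∈ orders S) {a : α} :
    a ∈ r ↔ a ∈ S := by
  rw [← Multiset.mem_coe, mem_orders.mp h, Finset.mem_val]

theorem mem_orders_of_nodup {S : Finset α} {r : List α} (h : r.Nodup) (h' : ∀ a, a ∈ r ↔ a ∈ S) :
    r ∈ orders S := by
  rw [mem_orders, Multiset.Nodup.ext (Multiset.coe_nodup.mpr h) S.nodup]
  simpa using h'

theorem length_of_mem_orders {S : Finset α} {r : List α} (h : r ∈ orders S) :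
    r.length = S.card := by
  rw [← Multiset.coe_card, mem_orders.mp h, Finset.card_def]

variable [LinearOrder α] [LinearOrder β]

/-- The antisymmetric version of the PWO factor, which vanishes on the diagonal. -/
def ordSign (i j : α) (r : List α) : ℤ :=
  if r.idxOf i < r.idxOf j then 1 else if r.idxOf j < r.idxOf i then -1 else 0

theorem ordSign_swap (i j : α) (r : List α) : ordSign j i r = -ordSign i j r := by
  unfold ordSign
  split_ifs <;> omega

@[simp] theorem ordSign_self (i : α) (r : List α) : ordSign i i r = 0 := by
  simp [ordSign]

theorem ordSign_eq_one_iff {i j : α} {r : List α} : ordSign i j r = 1 ↔ Precedes i j r := by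
  unfold ordSign Precedes
  split_ifs <;> simp_all

theorem ordSign_eq_pwo {i j : α} {r : List α} (hi : i ∈ r) (hij : i ≠ j) :
    ordSign i j r = pwo i j r := by
  have h : r.idxOf i ≠ r.idxOf j := fun h => hij ((List.idxOf_inj hi).mp h)
  unfold ordSign pwo Precedes
  split_ifs <;> omega

theorem ordSign_mul_self {i j : α} {r : List α} (hi : i ∈ r) (hij : i ≠ j) :
    ordSign i j r * ordSign i j r = 1 := by
  rw [ordSign_eq_pwo hi hij, pwo]
  split_ifs <;> simp

/-- Exactly one of the three components lies between the other two; its product is -1 and the other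
two products are 1. -/
theorem ordSign_triple {a b c : α} {r : List α} (ha : a ∈ r) (hb : b ∈ r)
    (hab : a ≠ b) (hac : a ≠ c) (hbc : b ≠ c) :
    ordSign a b r * ordSign a c r + ordSign b a r * ordSign b c r +
      ordSign c a r * ordSign c b r = 1 := by
  have h1 : r.idxOf a ≠ r.idxOf b := fun h => hab ((List.idxOf_inj ha).mp h)
  have h2 : r.idxOf a ≠ r.idxOf c := fun h => hac ((List.idxOf_inj ha).mp h)
  have h3 : r.idxOf b ≠ r.idxOf c := fun h => hbc ((List.idxOf_inj hb).mp h)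
  unfold ordSign
  split_ifs <;> omega

theorem ordSign_append_of_mem {i j : α} {r s : List α} (hi : i ∈ r) (hj : j ∈ r) :
    ordSign i j (r ++ s) = ordSign i j r := by
  simp [ordSign, List.idxOf_append, hi, hj]

theorem ordSign_append_of_notMem {i j : α} {r s : List α} (hi : i ∉ r) (hj : j ∉ r) :
    ordSign i j (r ++ s) = ordSign i j s := by
  simp [ordSign, List.idxOf_append, hi, hj]

theorem ordSign_append_of_mem_of_notMem {i j : α} {r s : List α} (hi : i ∈ r) (hj : j ∉ r) :
    ordSign i j (r ++ s) = 1 := by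
  have := List.idxOf_lt_length_of_mem hi
  simp only [ordSign, List.idxOf_append, hi, hj, if_true, if_false]
  rw [if_pos (by omega)]

theorem ordSign_append_of_notMem_of_mem {i j : α} {r s : List α} (hi : i ∉ r) (hj : j ∈ r) :
    ordSign i j (r ++ s) = -1 := by
  rw [ordSign_swap, ordSign_append_of_mem_of_notMem hj hi]

theorem ordSign_cons_of_ne {i j x : α} {r : List α} (hi : i ≠ x) (hj : j ≠ x) :
    ordSign i j (x :: r) = ordSign i j r :=
  ordSign_append_of_notMem (r := [x]) (by simpa using hi) (by simpa using hj)

theorem ordSign_cons_left {j x : α} {r : List α} (hj : j ≠ x) : ordSign x j (x :: r) = 1 :=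
  ordSign_append_of_mem_of_notMem (r := [x]) (by simp) (by simpa using hj)

theorem ordSign_cons_right {i x : α} {r : List α} (hi : i ≠ x) : ordSign i x (x :: r) = -1 := by
  rw [ordSign_swap, ordSign_cons_left hi]

theorem ordSign_reverse {i j : α} {r : List α} (hr : r.Nodup) (hi : i ∈ r) (hj : j ∈ r) :
    ordSign i j r.reverse = -ordSign i j r := by
  induction r with
  | nil => simp at hi
  | cons x r ih =>
    rw [List.nodup_cons] at hr
    rw [List.reverse_cons]
    by_cases hix : i = x <;> by_cases hjx : j = x
    · subst hix hjx; simp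
    · subst hix
      have hj' : j ∈ r := by simpa [hjx] using hj
      rw [ordSign_append_of_notMem_of_mem (by simpa using hr.1) (by simpa using hj'),
        ordSign_cons_left hjx]
    · subst hjx
      have hi' : i ∈ r := by simpa [hix] using hi
      rw [ordSign_append_of_mem_of_notMem (by simpa using hi') (by simpa using hr.1),
        ordSign_cons_right hix, neg_neg]
    · have hi' : i ∈ r := by simpa [hix] using hi
      have hj' : j ∈ r := by simpa [hjx] using hj
      rw [ordSign_append_of_mem (by simpa using hi') (by simpa using hj'),
        ordSign_cons_of_ne hix hjx, ih hr.2 hi' hj']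

theorem idxOf_map_of_injective {f : β → α} (hf : Function.Injective f) (a : β) (r : List β) :
    (r.map f).idxOf (f a) = r.idxOf a := by
  induction r with
  | nil => simp
  | cons x r ih =>
    rw [List.map_cons, List.idxOf_cons, List.idxOf_cons, ih]
    by_cases h : x = a
    · simp [h]
    · have : f x ≠ f a := fun h' => h (hf h')
      simp [beq_eq_false_iff_ne.mpr h, beq_eq_false_iff_ne.mpr this]

theorem ordSign_map {f : β → α} (hf : Function.Injective f) (a b : β) (r : List β) :
    ordSign (f a) (f b) (r.map f) = ordSign a b r := by
  simp only [ordSign, idxOf_map_of_injective hf]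

/-- The sum over the rows of an array of the product of two PWO factors. -/
def pairSum (D : List (List α)) (a b c d : α) : ℤ :=
  (D.map fun r => ordSign a b r * ordSign c d r).sum

theorem pairSum_swap_left (D : List (List α)) (a b c d : α) :
    pairSum D b a c d = -pairSum D a b c d := by
  unfold pairSum
  induction D with
  | nil => simp
  | cons r D ih =>
    rw [List.map_cons, List.sum_cons, ih, ordSign_swap a b, List.map_cons, List.sum_cons]
    ring

theorem pairSum_comm (D : List (List α)) (a b c d : α) :
    pairSum D a b c d = pairSum D c d a b := by
  simp only [pairSum, mul_comm]

theorem pairSum_swap_right (D : List (List α)) (a b c d : α) :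
    pairSum D a b d c = -pairSum D a b c d := by
  rw [pairSum_comm, pairSum_swap_left, pairSum_comm]

/-- Three times the product moment of two PWO factors under the uniform distribution. -/
def pairCov (a b c d : α) : ℤ :=
  (if a = c then 1 else 0) - (if a = d then 1 else 0) - (if b = c then 1 else 0) +
    (if b = d then 1 else 0) + (if a = c then 1 else 0) * (if b = d then 1 else 0) -
    (if a = d then 1 else 0) * (if b = c then 1 else 0)

/-- The rows of `D` are orders of `S`, and the second moments of the PWO factors are the same as
in the array of all orders. -/
structure IsPairBalanced (S : Finset α) (D : List (List α)) : Prop where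
  mem_orders : ∀ r ∈ D, r ∈ orders S
  pairSum_eq : ∀ a ∈ S, ∀ b ∈ S, ∀ c ∈ S, ∀ d ∈ S,
    3 * pairSum D a b c d = D.length * pairCov a b c d

/-- The PWO factors have mean zero. -/
def IsCentered (S : Finset α) (D : List (List α)) : Prop :=
  ∀ a ∈ S, ∀ b ∈ S, (D.map (ordSign a b)).sum = 0

theorem pairSum_self {S : Finset α} {D : List (List α)} (hD : ∀ r ∈ D, r ∈ orders S)
    {a b : α} (ha : a ∈ S) (hab : a ≠ b) : pairSum D a b a b = D.length := by
  unfold pairSum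
  rw [List.map_congr_left (g := fun _ => (1 : ℤ))
    fun r hr => ordSign_mul_self ((mem_iff_of_mem_orders (hD r hr)).mpr ha) hab]
  simp

theorem pairSum_triple {S : Finset α} {D : List (List α)} (hD : ∀ r ∈ D, r ∈ orders S)
    {a b c : α} (ha : a ∈ S) (hb : b ∈ S) (hab : a ≠ b) (hac : a ≠ c) (hbc : b ≠ c) :
    pairSum D a b a c + pairSum D b a b c + pairSum D c a c b = D.length := by
  unfold pairSum
  rw [← List.sum_map_add, ← List.sum_map_add, List.map_congr_left (g := fun _ => (1 : ℤ))
    fun r hr => ordSign_triple ((mem_iff_of_mem_orders (hD r hr)).mpr ha)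
      ((mem_iff_of_mem_orders (hD r hr)).mpr hb) hab hac hbc]
  simp

/-- Antisymmetry of the signs and the fact that their squares are 1 leave two shapes to check: two
factors that share one component, and two factors on four components. -/
theorem IsPairBalanced.of_distinct {S : Finset α} {D : List (List α)}
    (hD : ∀ r ∈ D, r ∈ orders S)
    (h3 : ∀ a ∈ S, ∀ b ∈ S, ∀ c ∈ S, a ≠ b → a ≠ c → b ≠ c →
      3 * pairSum D a b a c = D.length)
    (h4 : ∀ a ∈ S, ∀ b ∈ S, ∀ c ∈ S, ∀ d ∈ S, a ≠ b → a ≠ c → a ≠ d → b ≠ c → b ≠ d → c ≠ d →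
      pairSum D a b c d = 0) : IsPairBalanced S D := by
  refine ⟨hD, fun a ha b hb c hc d hd => ?_⟩
  rcases eq_or_ne a b with rfl | hab
  · have h : pairCov a a c d = 0 := by unfold pairCov; ring
    simp [pairSum, h]
  rcases eq_or_ne c d with rfl | hcd
  · have h : pairCov a b c c = 0 := by unfold pairCov; ring
    simp [pairSum, h]
  by_cases hac : a = c
  · subst hac
    by_cases hbd : b = d
    · subst hbd
      simp only [pairSum_self hD ha hab, pairCov, hab, hab.symm, if_true, if_false]
      ring
    · simp [h3 a ha b hb d hd hab hcd hbd, pairCov, hab.symm, hcd, hbd]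
  by_cases had : a = d
  · subst had
    rw [pairSum_swap_right]
    by_cases hbc : b = c
    · subst hbc
      simp only [pairSum_self hD ha hab, pairCov, hab, hab.symm, if_true, if_false]
      ring
    · simp [h3 a ha b hb c hc hab hac hbc, pairCov, hab.symm, hac, hbc]
  by_cases hbc : b = c
  · subst hbc
    rw [pairSum_swap_left]
    simp [h3 b hb a ha d hd hab.symm hcd had, pairCov, hab, hcd, had]
  by_cases hbd : b = d
  · subst hbd
    rw [pairSum_swap_left, pairSum_swap_right]
    simp [h3 b hb a ha c hc hab.symm (Ne.symm hcd) hac, pairCov, hab, hbc, hac]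
  · simp [h4 a ha b hb c hc d hd hab hac had hbc hbd hcd, pairCov, hac, had, hbc, hbd]

/-- A symmetric triple of product moments is balanced. -/
theorem three_mul_pairSum_of_symm {S : Finset α} {D : List (List α)}
    (hD : ∀ r ∈ D, r ∈ orders S)
    (h : ∀ a ∈ S, ∀ b ∈ S, ∀ c ∈ S, a ≠ b → a ≠ c → b ≠ c →
      pairSum D a b a c = pairSum D b a b c) :
    ∀ a ∈ S, ∀ b ∈ S, ∀ c ∈ S, a ≠ b → a ≠ c → b ≠ c →
      3 * pairSum D a b a c = D.length := by
  intro a ha b hb c hc hab hac hbc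
  have h1 := h a ha b hb c hc hab hac hbc
  have h2 := h a ha c hc b hb hac hab hbc.symm
  rw [pairSum_comm] at h2
  have := pairSum_triple hD ha hb hab hac hbc
  linarith

theorem IsPairBalanced.map {S : Finset β} {D : List (List β)} (h : IsPairBalanced S D)
    {f : β → α} (hf : Function.Injective f) :
    IsPairBalanced (S.image f) (D.map (List.map f)) := by
  refine ⟨fun r hr => ?_, ?_⟩
  · obtain ⟨s, hs, rfl⟩ := List.mem_map.mp hr
    have hs' := h.mem_orders s hs
    refine mem_orders_of_nodup ((nodup_of_mem_orders hs').map hf) fun a => ?_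
    simp [mem_iff_of_mem_orders hs']
  · simp only [Finset.forall_mem_image]
    intro a ha b hb c hc d hd
    have := h.pairSum_eq a ha b hb c hc d hd
    simp only [pairSum, List.map_map, Function.comp_def, ordSign_map hf, pairCov, hf.eq_iff,
      List.length_map] at this ⊢
    exact this

theorem IsCentered.map {S : Finset β} {D : List (List β)} (h : IsCentered S D)
    {f : β → α} (hf : Function.Injective f) : IsCentered (S.image f) (D.map (List.map f)) := by
  simp only [IsCentered, Finset.forall_mem_image]
  intro a ha b hb
  have := h a ha b hb
  simpa only [List.map_map, Function.comp_def, ordSign_map hf] using this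

end PairMoments

end OofA

/-! ### Juxtaposition of arrays for a block and its complement. -/

namespace OofA

section Blocks

variable {α : Type*}

theorem beside_eq_map_zip (A B : List (List α)) :
    beside A B = (A.zip B).map fun p => p.1 ++ p.2 := by
  simp [beside, List.zip]

theorem beside_eq_map_zip_swap (A B : List (List α)) :
    beside B A = (A.zip B).map fun p => p.2 ++ p.1 := by
  rw [beside_eq_map_zip, ← List.zip_swap A B, List.map_map]
  rfl

theorem beside_colReverse_eq_map_zip (A B : List (List α)) :
    beside A (colReverse B) = (A.zip B).map fun p => p.1 ++ p.2.reverse := by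
  rw [beside_eq_map_zip, colReverse, List.zip_map_right, List.map_map]
  rfl

theorem colReverse_beside_eq_map_zip (A B : List (List α)) :
    beside (colReverse B) A = (A.zip B).map fun p => p.2.reverse ++ p.1 := by
  rw [beside_eq_map_zip_swap, colReverse, List.zip_map_right, List.map_map]
  rfl

theorem sum_zip_fst {A B : List (List α)} (hlen : A.length = B.length) (F : List α → ℤ) :
    ((A.zip B).map fun p => F p.1).sum = (A.map F).sum := by
  conv_rhs => rw [← List.map_fst_zip hlen.le, List.map_map]
  rfl

theorem sum_zip_snd {A B : List (List α)} (hlen : A.length = B.length) (F : List α → ℤ) :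
    ((A.zip B).map fun p => F p.2).sum = (B.map F).sum := by
  conv_rhs => rw [← List.map_snd_zip hlen.ge, List.map_map]
  rfl

theorem reverse_mem_orders {S : Finset α} {x : List α} : x.reverse ∈ orders S ↔ x ∈ orders S := by
  rw [mem_orders, mem_orders, Multiset.coe_reverse]

theorem perm_mem_orders {S : Finset α} {x y : List α} (h : x.Perm y) (hx : x ∈ orders S) :
    y ∈ orders S := by
  rw [mem_orders] at *
  rw [← hx, Multiset.coe_eq_coe]
  exact h.symm

theorem mem_orders_of_mem_zip {S T : Finset α} {A B : List (List α)}
    (hA : ∀ r ∈ A, r ∈ orders S) (hB : ∀ r ∈ B, r ∈ orders T) {p : List α × List α}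
    (hp : p ∈ A.zip B) : p.1 ∈ orders S ∧ p.2 ∈ orders T :=
  ⟨hA _ (List.of_mem_zip hp).1, hB _ (List.of_mem_zip hp).2⟩

variable [LinearOrder α]

/-- The indicator of membership in a block. -/
def blockInd (o : Finset α) (a : α) : ℤ := if a ∈ o then 1 else 0

theorem append_mem_orders {G o : Finset α} (ho : o ⊆ G) {x y : List α} (hx : x ∈ orders o)
    (hy : y ∈ orders (G \ o)) : x ++ y ∈ orders G := by
  refine mem_orders_of_nodup (List.nodup_append'.mpr ⟨nodup_of_mem_orders hx,
    nodup_of_mem_orders hy, fun a ha ha' => ?_⟩) fun a => ?_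
  · rw [mem_iff_of_mem_orders hx] at ha
    rw [mem_iff_of_mem_orders hy, Finset.mem_sdiff] at ha'
    exact ha'.2 ha
  · rw [List.mem_append, mem_iff_of_mem_orders hx, mem_iff_of_mem_orders hy, Finset.mem_sdiff]
    have := @ho a
    tauto

theorem ordSign_append (a b : α) (x y : List α) :
    ordSign a b (x ++ y) = ((if a ∈ x then 1 else 0) - (if b ∈ x then 1 else 0)) +
      (if a ∈ x then 1 else 0) * (if b ∈ x then 1 else 0) * ordSign a b x +
      (1 - if a ∈ x then 1 else 0) * (1 - if b ∈ x then 1 else 0) * ordSign a b y := by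
  by_cases ha : a ∈ x <;> by_cases hb : b ∈ x
  · simp [ha, hb, ordSign_append_of_mem]
  · simp [ha, hb, ordSign_append_of_mem_of_notMem]
  · simp [ha, hb, ordSign_append_of_notMem_of_mem]
  · simp [ha, hb, ordSign_append_of_notMem]

/-- A sign splits into a block part, which depends only on which components lie in `o`, a part from
`x` and a part from `y`. The block constructions are analysed by the behaviour of these three parts
in the two halves of the array. -/
theorem ordSign_append_block {o : Finset α} {x y : List α} (hx : x ∈ orders o) (a b : α) :
    ordSign a b (x ++ y) = (blockInd o a - blockInd o b) +
      blockInd o a * blockInd o b * ordSign a b x +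
      (1 - blockInd o a) * (1 - blockInd o b) * ordSign a b y := by
  simp only [ordSign_append, blockInd, mem_iff_of_mem_orders hx]

theorem ordSign_append_coblock {G o : Finset α} {x y : List α} (hy : y ∈ orders (G \ o))
    {a b : α} (ha : a ∈ G) (hb : b ∈ G) :
    ordSign a b (y ++ x) = -(blockInd o a - blockInd o b) +
      blockInd o a * blockInd o b * ordSign a b x +
      (1 - blockInd o a) * (1 - blockInd o b) * ordSign a b y := by
  simp only [ordSign_append, blockInd, mem_iff_of_mem_orders hy, Finset.mem_sdiff, ha, hb,
    true_and]
  by_cases h : a ∈ o <;> by_cases h' : b ∈ o <;> simp [h, h']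

theorem coblock_mul_ordSign_reverse {G o : Finset α} {y : List α} (hy : y ∈ orders (G \ o))
    {a b : α} (ha : a ∈ G) (hb : b ∈ G) :
    (1 - blockInd o a) * (1 - blockInd o b) * ordSign a b y.reverse =
      -((1 - blockInd o a) * (1 - blockInd o b) * ordSign a b y) := by
  by_cases h : a ∈ o <;> by_cases h' : b ∈ o <;> simp only [blockInd, h, h', if_true, if_false,
    sub_self, zero_mul, mul_zero, neg_zero]
  rw [ordSign_reverse (nodup_of_mem_orders hy)
    ((mem_iff_of_mem_orders hy).mpr (Finset.mem_sdiff.mpr ⟨ha, h⟩))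
    ((mem_iff_of_mem_orders hy).mpr (Finset.mem_sdiff.mpr ⟨hb, h'⟩))]
  ring

/-- The product of indicators vanishes wherever balance gives no information, so the identity holds
for arbitrary components and later sums need no case distinction. -/
theorem IsPairBalanced.block_mul {o : Finset α} {A : List (List α)} (hA : IsPairBalanced o A)
    (a b c d : α) :
    blockInd o a * blockInd o b * blockInd o c * blockInd o d * (3 * pairSum A a b c d) =
      A.length * (blockInd o a * blockInd o b * blockInd o c * blockInd o d *
        pairCov a b c d) := by
  by_cases h : a ∈ o ∧ b ∈ o ∧ c ∈ o ∧ d ∈ o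
  · rw [hA.pairSum_eq a h.1 b h.2.1 c h.2.2.1 d h.2.2.2]
    ring
  · have : blockInd o a * blockInd o b * blockInd o c * blockInd o d = 0 := by
      simp only [blockInd, mul_eq_zero, ite_eq_right_iff, one_ne_zero, imp_false]
      tauto
    rw [this]
    ring

theorem IsPairBalanced.coblock_mul {G o : Finset α} {A : List (List α)}
    (hA : IsPairBalanced (G \ o) A) {a b c d : α} (ha : a ∈ G) (hb : b ∈ G) (hc : c ∈ G)
    (hd : d ∈ G) :
    (1 - blockInd o a) * (1 - blockInd o b) * (1 - blockInd o c) * (1 - blockInd o d) *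
        (3 * pairSum A a b c d) =
      A.length * ((1 - blockInd o a) * (1 - blockInd o b) * (1 - blockInd o c) *
        (1 - blockInd o d) * pairCov a b c d) := by
  have h : ∀ x ∈ G, 1 - blockInd o x = blockInd (G \ o) x := fun x hx => by
    by_cases h : x ∈ o <;> simp [blockInd, h, hx]
  rw [h a ha, h b hb, h c hc, h d hd, hA.block_mul]

theorem IsCentered.block_mul {o : Finset α} {A : List (List α)} (hA : IsCentered o A)
    (a b : α) : blockInd o a * blockInd o b * (A.map (ordSign a b)).sum = 0 := by
  by_cases h : a ∈ o ∧ b ∈ o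
  · rw [hA a h.1 b h.2, mul_zero]
  · have : blockInd o a * blockInd o b = 0 := by
      simp only [blockInd, mul_eq_zero, ite_eq_right_iff, one_ne_zero, imp_false]
      tauto
    rw [this, zero_mul]

theorem IsCentered.coblock_mul {G o : Finset α} {A : List (List α)} (hA : IsCentered (G \ o) A)
    {a b : α} (ha : a ∈ G) (hb : b ∈ G) :
    (1 - blockInd o a) * (1 - blockInd o b) * (A.map (ordSign a b)).sum = 0 := by
  have h : ∀ x ∈ G, 1 - blockInd o x = blockInd (G \ o) x := fun x hx => by
    by_cases h : x ∈ o <;> simp [blockInd, h, hx]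
  rw [h a ha, h b hb, hA.block_mul]

/-- The second moments of an array whose rows juxtapose balanced arrays for a block `o` and its
complement. -/
structure IsBlockBalanced (G o : Finset α) (D : List (List α)) : Prop where
  mem_orders : ∀ r ∈ D, r ∈ orders G
  pairSum_eq : ∀ a ∈ G, ∀ b ∈ G, ∀ c ∈ G, ∀ d ∈ G,
    3 * pairSum D a b c d = D.length *
      (3 * ((blockInd o a - blockInd o b) * (blockInd o c - blockInd o d)) +
        (blockInd o a * blockInd o b * blockInd o c * blockInd o d +
          (1 - blockInd o a) * (1 - blockInd o b) * (1 - blockInd o c) * (1 - blockInd o d)) *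
            pairCov a b c d)

/-- The moments of the array `[A, B; ∼B, A]`. -/
theorem IsBlockBalanced.crossed {G o : Finset α} (ho : o ⊆ G) {A B : List (List α)}
    (hlen : A.length = B.length) (hA : IsPairBalanced o A) (hB : IsPairBalanced (G \ o) B)
    (hB0 : IsCentered (G \ o) B) :
    IsBlockBalanced G o (beside A B ++ beside (colReverse B) A) := by
  rw [beside_eq_map_zip, colReverse_beside_eq_map_zip]
  have hmem := fun p => mem_orders_of_mem_zip (p := p) hA.mem_orders hB.mem_orders
  refine ⟨fun r hr => ?_, fun a ha b hb c hc d hd => ?_⟩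
  · simp only [List.mem_append, List.mem_map] at hr
    rcases hr with ⟨p, hp, rfl⟩ | ⟨p, hp, rfl⟩
    · exact append_mem_orders ho (hmem p hp).1 (hmem p hp).2
    · exact perm_mem_orders List.perm_append_comm
        (append_mem_orders ho (hmem p hp).1 (reverse_mem_orders.mpr (hmem p hp).2))
  -- In the second half the block part and the `B` part change sign while the `A` part does not.
  -- Products with the `A` part therefore cancel, whatever the matching of rows of `A` with rows of
  -- `B`. Products of the block part with the `B` part add up and are removed by the centering of
  -- `B`; `A` need not be centered.
  · have key : pairSum ((A.zip B).map (fun p => p.1 ++ p.2) ++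
          (A.zip B).map (fun p => p.2.reverse ++ p.1)) a b c d =
        2 * (B.length * ((blockInd o a - blockInd o b) * (blockInd o c - blockInd o d)) +
          blockInd o a * blockInd o b * blockInd o c * blockInd o d * pairSum A a b c d +
          (1 - blockInd o a) * (1 - blockInd o b) * (1 - blockInd o c) * (1 - blockInd o d) *
            pairSum B a b c d +
          (blockInd o a - blockInd o b) *
            ((1 - blockInd o c) * (1 - blockInd o d) * (B.map (ordSign c d)).sum) +
          (blockInd o c - blockInd o d) *
            ((1 - blockInd o a) * (1 - blockInd o b) * (B.map (ordSign a b)).sum)) := by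
      have hlenB : (B.length : ℤ) = ((A.zip B).map fun _ => (1 : ℤ)).sum := by
        simp [hlen]
      simp only [pairSum, List.map_append, List.sum_append, List.map_map, Function.comp_def]
      rw [← sum_zip_fst hlen fun r => ordSign a b r * ordSign c d r,
        ← sum_zip_snd hlen fun r => ordSign a b r * ordSign c d r,
        ← sum_zip_snd hlen (ordSign c d), ← sum_zip_snd hlen (ordSign a b), hlenB,
        ← List.sum_map_mul_right, ← List.sum_map_mul_left, ← List.sum_map_mul_left,
        ← List.sum_map_mul_left, ← List.sum_map_mul_left, ← List.sum_map_mul_left,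
        ← List.sum_map_mul_left,
        ← List.sum_map_add, ← List.sum_map_add, ← List.sum_map_add, ← List.sum_map_add,
        ← List.sum_map_add, ← List.sum_map_mul_left]
      refine congrArg List.sum (List.map_congr_left fun p hp => ?_)
      obtain ⟨h1, h2⟩ := hmem p hp
      have h2' := reverse_mem_orders.mpr h2
      rw [ordSign_append_block h1, ordSign_append_block h1,
        ordSign_append_coblock h2' ha hb, ordSign_append_coblock h2' hc hd,
        coblock_mul_ordSign_reverse h2 ha hb, coblock_mul_ordSign_reverse h2 hc hd]
      ring
    rw [key, hB0.coblock_mul ha hb, hB0.coblock_mul hc hd]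
    have e1 := hA.block_mul a b c d
    have e2 := hB.coblock_mul ha hb hc hd
    rw [hlen] at e1
    simp only [List.length_append, List.length_map, List.length_zip, hlen, min_self]
    push_cast
    linear_combination 2 * e1 + 2 * e2

/-- The moments of the array `[A, B; A, ∼B]`. -/
theorem IsBlockBalanced.parallel {G o : Finset α} (ho : o ⊆ G) {A B : List (List α)}
    (hlen : A.length = B.length) (hA : IsPairBalanced o A) (hB : IsPairBalanced (G \ o) B)
    (hA0 : IsCentered o A) :
    IsBlockBalanced G o (beside A B ++ beside A (colReverse B)) := by
  rw [beside_eq_map_zip, beside_colReverse_eq_map_zip]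
  have hmem := fun p => mem_orders_of_mem_zip (p := p) hA.mem_orders hB.mem_orders
  refine ⟨fun r hr => ?_, fun a ha b hb c hc d hd => ?_⟩
  · simp only [List.mem_append, List.mem_map] at hr
    rcases hr with ⟨p, hp, rfl⟩ | ⟨p, hp, rfl⟩
    · exact append_mem_orders ho (hmem p hp).1 (hmem p hp).2
    · exact append_mem_orders ho (hmem p hp).1 (reverse_mem_orders.mpr (hmem p hp).2)
  -- Here only the `B` part changes sign, so the surviving mixed products are those of the block
  -- part with the `A` part, and it is `A` that must be centered.
  · have key : pairSum ((A.zip B).map (fun p => p.1 ++ p.2) ++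
          (A.zip B).map (fun p => p.1 ++ p.2.reverse)) a b c d =
        2 * (B.length * ((blockInd o a - blockInd o b) * (blockInd o c - blockInd o d)) +
          blockInd o a * blockInd o b * blockInd o c * blockInd o d * pairSum A a b c d +
          (1 - blockInd o a) * (1 - blockInd o b) * (1 - blockInd o c) * (1 - blockInd o d) *
            pairSum B a b c d +
          (blockInd o a - blockInd o b) *
            (blockInd o c * blockInd o d * (A.map (ordSign c d)).sum) +
          (blockInd o c - blockInd o d) *
            (blockInd o a * blockInd o b * (A.map (ordSign a b)).sum)) := by
      have hlenB : (B.length : ℤ) = ((A.zip B).map fun _ => (1 : ℤ)).sum := by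
        simp [hlen]
      simp only [pairSum, List.map_append, List.sum_append, List.map_map, Function.comp_def]
      rw [← sum_zip_fst hlen fun r => ordSign a b r * ordSign c d r,
        ← sum_zip_snd hlen fun r => ordSign a b r * ordSign c d r,
        ← sum_zip_fst hlen (ordSign c d), ← sum_zip_fst hlen (ordSign a b), hlenB,
        ← List.sum_map_mul_right, ← List.sum_map_mul_left, ← List.sum_map_mul_left,
        ← List.sum_map_mul_left, ← List.sum_map_mul_left, ← List.sum_map_mul_left,
        ← List.sum_map_mul_left,
        ← List.sum_map_add, ← List.sum_map_add, ← List.sum_map_add, ← List.sum_map_add,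
        ← List.sum_map_add, ← List.sum_map_mul_left]
      refine congrArg List.sum (List.map_congr_left fun p hp => ?_)
      obtain ⟨h1, h2⟩ := hmem p hp
      rw [ordSign_append_block h1, ordSign_append_block h1,
        ordSign_append_block h1, ordSign_append_block h1,
        coblock_mul_ordSign_reverse h2 ha hb, coblock_mul_ordSign_reverse h2 hc hd]
      ring
    rw [key, hA0.block_mul, hA0.block_mul]
    have e1 := hA.block_mul a b c d
    have e2 := hB.coblock_mul ha hb hc hd
    rw [hlen] at e1
    simp only [List.length_append, List.length_map, List.length_zip, hlen, min_self]
    push_cast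
    linear_combination 2 * e1 + 2 * e2

/-- If `A` and `B` are centered, so is `[A, B; ∼B, A]`. -/
theorem IsCentered.crossed {G o : Finset α} {A B : List (List α)}
    (hlen : A.length = B.length) (hA : ∀ r ∈ A, r ∈ orders o) (hB : ∀ r ∈ B, r ∈ orders (G \ o))
    (hA0 : IsCentered o A) :
    IsCentered G (beside A B ++ beside (colReverse B) A) := by
  intro a ha b hb
  rw [beside_eq_map_zip, colReverse_beside_eq_map_zip]
  have key : (((A.zip B).map (fun p => p.1 ++ p.2) ++
        (A.zip B).map (fun p => p.2.reverse ++ p.1)).map (ordSign a b)).sum =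
      2 * (blockInd o a * blockInd o b * (A.map (ordSign a b)).sum) := by
    simp only [List.map_append, List.sum_append, List.map_map, Function.comp_def]
    rw [← sum_zip_fst hlen (ordSign a b), ← List.sum_map_mul_left, ← List.sum_map_mul_left,
      ← List.sum_map_add]
    refine congrArg List.sum (List.map_congr_left fun p hp => ?_)
    obtain ⟨h1, h2⟩ := mem_orders_of_mem_zip hA hB hp
    have h2' := reverse_mem_orders.mpr h2
    rw [ordSign_append_block h1, ordSign_append_coblock h2' ha hb,
      coblock_mul_ordSign_reverse h2 ha hb]
    ring
  rw [key, hA0.block_mul, mul_zero]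

/-- Stacking block-balanced arrays of the same size gives a balanced array if the blocks separate
the elements of `G` evenly. -/
theorem IsPairBalanced.flatten_of_blocks {ι : Type*} {G : Finset α} (L : List ι)
    (o : ι → Finset α) (E : ι → List (List α)) (N : ℕ)
    (hE : ∀ l ∈ L, IsBlockBalanced G (o l) (E l) ∧ (E l).length = N)
    (h3 : ∀ a ∈ G, ∀ b ∈ G, ∀ c ∈ G, a ≠ b → a ≠ c → b ≠ c →
      (L.map fun l => (blockInd (o l) a - blockInd (o l) b) *
        (blockInd (o l) a - blockInd (o l) c)).sum =
      (L.map fun l => (blockInd (o l) b - blockInd (o l) a) *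
        (blockInd (o l) b - blockInd (o l) c)).sum)
    (h4 : ∀ a ∈ G, ∀ b ∈ G, ∀ c ∈ G, ∀ d ∈ G, a ≠ b → a ≠ c → a ≠ d → b ≠ c → b ≠ d → c ≠ d →
      (L.map fun l => (blockInd (o l) a - blockInd (o l) b) *
        (blockInd (o l) c - blockInd (o l) d)).sum = 0) :
    IsPairBalanced G (L.map E).flatten := by
  have hrows : ∀ r ∈ (L.map E).flatten, r ∈ orders G := by
    intro r hr
    obtain ⟨_, hl', hr⟩ := List.mem_flatten.mp hr
    obtain ⟨l, hl, rfl⟩ := List.mem_map.mp hl'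
    exact (hE l hl).1.mem_orders r hr
  have hsum : ∀ a ∈ G, ∀ b ∈ G, ∀ c ∈ G, ∀ d ∈ G, 3 * pairSum (L.map E).flatten a b c d =
      N * (L.map fun l =>
        (3 * ((blockInd (o l) a - blockInd (o l) b) * (blockInd (o l) c - blockInd (o l) d)) +
        (blockInd (o l) a * blockInd (o l) b * blockInd (o l) c * blockInd (o l) d +
          (1 - blockInd (o l) a) * (1 - blockInd (o l) b) * (1 - blockInd (o l) c) *
            (1 - blockInd (o l) d)) * pairCov a b c d)).sum := by
    intro a ha b hb c hc d hd
    have : pairSum (L.map E).flatten a b c d = (L.map fun l => pairSum (E l) a b c d).sum := by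
      simp only [pairSum, List.map_flatten, List.sum_flatten, List.map_map, Function.comp_def]
    rw [this, ← List.sum_map_mul_left, ← List.sum_map_mul_left]
    refine congrArg List.sum (List.map_congr_left fun l hl => ?_)
    rw [(hE l hl).1.pairSum_eq a ha b hb c hc d hd, (hE l hl).2]
  refine IsPairBalanced.of_distinct hrows
    (three_mul_pairSum_of_symm hrows fun a ha b hb c hc hab hac hbc => ?_)
    fun a ha b hb c hc d hd hab hac had hbc hbd hcd => ?_
  · have e1 := hsum a ha b hb a ha c hc
    have e2 := hsum b hb a ha b hb c hc
    have k1 : pairCov a b a c = 1 := by simp [pairCov, hab.symm, hac, hbc]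
    have k2 : pairCov b a b c = 1 := by simp [pairCov, hab, hac, hbc]
    rw [k1, List.sum_map_add, List.sum_map_mul_left, h3 a ha b hb c hc hab hac hbc] at e1
    rw [k2, List.sum_map_add, List.sum_map_mul_left] at e2
    -- The contribution from inside the blocks is already symmetric: it tests whether all three
    -- components lie on the same side of the block.
    have e3 : (L.map fun l => (blockInd (o l) a * blockInd (o l) b * blockInd (o l) a *
          blockInd (o l) c + (1 - blockInd (o l) a) * (1 - blockInd (o l) b) *
          (1 - blockInd (o l) a) * (1 - blockInd (o l) c)) * (1 : ℤ)) =
        L.map fun l => (blockInd (o l) b * blockInd (o l) a * blockInd (o l) b *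
          blockInd (o l) c + (1 - blockInd (o l) b) * (1 - blockInd (o l) a) *
          (1 - blockInd (o l) b) * (1 - blockInd (o l) c)) * (1 : ℤ) := by
      refine List.map_congr_left fun l _ => ?_
      unfold blockInd
      split_ifs <;> rfl
    rw [e3] at e1
    linarith
  · have e1 := hsum a ha b hb c hc d hd
    have k : pairCov a b c d = 0 := by simp [pairCov, hac, had, hbc, hbd]
    simp only [k, mul_zero, add_zero] at e1
    rw [List.sum_map_mul_left, h4 a ha b hb c hc d hd hab hac had hbc hbd hcd] at e1
    linarith

end Blocks

end OofA

/-! ### Full arrays, arrays of strength 2, and groups without constraint. -/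

namespace OofA

section Arrays

variable {α : Type*}

theorem card_orders (S : Finset α) : (orders S).card = S.card.factorial := by
  have key : ∀ s : Multiset α, Multiset.card s.lists = (Multiset.card s).factorial := by
    intro s
    induction s using Quotient.inductionOn with
    | h l => exact List.length_permutations l
  exact key S.val

theorem card_orders_pos (S : Finset α) : 0 < (orders S).card := by
  rw [card_orders]
  exact Nat.factorial_pos _

theorem Enumerates.mem_iff {β : Type*} {L : List β} {S : Finset β} (h : Enumerates L S) {x : β} :
    x ∈ L ↔ x ∈ S := by
  rw [← Multiset.mem_coe, show (L : Multiset β) = S.val from h, Finset.mem_val]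

theorem Enumerates.length_eq {β : Type*} {L : List β} {S : Finset β} (h : Enumerates L S) :
    L.length = S.card := by
  rw [← Multiset.coe_card, show (L : Multiset β) = S.val from h, Finset.card_def]

theorem Enumerates.sum_map {β : Type*} {L : List β} {S : Finset β} (h : Enumerates L S)
    (F : β → ℤ) : (L.map F).sum = ∑ x ∈ S, F x := by
  rw [Finset.sum, ← show (L : Multiset β) = S.val from h, Multiset.map_coe, Multiset.sum_coe]

theorem sum_map_ite {β : Type*} (L : List β) (p : β → Prop) [DecidablePred p] :
    (L.map fun x => if p x then (1 : ℤ) else 0).sum = L.countP fun x => decide (p x) := by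
  induction L with
  | nil => simp
  | cons x L ih =>
    rw [List.map_cons, List.sum_cons, ih, List.countP_cons]
    by_cases h : p x <;> simp [h, add_comm]

variable [LinearOrder α]

/-- Invariance under relabelling by a transposition; it supplies every symmetry of the full array
that is needed. -/
theorem sum_orders_swap {S : Finset α} {x y : α} (hx : x ∈ S) (hy : y ∈ S)
    (F : List α → ℤ) :
    ∑ r ∈ orders S, F (r.map (Equiv.swap x y)) = ∑ r ∈ orders S, F r := by
  have hinv : ∀ r : List α, (r.map (Equiv.swap x y)).map (Equiv.swap x y) = r := fun r => by
    rw [List.map_map]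
    convert List.map_id r
    ext a
    simp
  have hS : ∀ a, Equiv.swap x y a ∈ S ↔ a ∈ S := fun a => by
    rw [Equiv.swap_apply_def]
    split_ifs with h1 h2 <;> simp_all
  have hmem : ∀ r ∈ orders S, r.map (Equiv.swap x y) ∈ orders S := fun r hr => by
    refine mem_orders_of_nodup ((nodup_of_mem_orders hr).map (Equiv.injective _)) fun a => ?_
    rw [← hS a, ← mem_iff_of_mem_orders hr, List.mem_map]
    constructor
    · rintro ⟨b, hb, rfl⟩
      simpa using hb
    · exact fun h => ⟨_, h, by simp⟩
  exact Finset.sum_nbij' (List.map (Equiv.swap x y)) (List.map (Equiv.swap x y)) hmem hmem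
    (fun r _ => hinv r) (fun r _ => hinv r) fun r _ => rfl

theorem ordSign_map_swap (x y a b : α) (r : List α) :
    ordSign a b (r.map (Equiv.swap x y)) =
      ordSign (Equiv.swap x y a) (Equiv.swap x y b) r := by
  have h := ordSign_map (Equiv.injective (Equiv.swap x y)) (Equiv.swap x y a) (Equiv.swap x y b) r
  rwa [Equiv.swap_apply_self, Equiv.swap_apply_self] at h

theorem Enumerates.isCentered {S : Finset α} {A : List (List α)} (h : Enumerates A (orders S)) :
    IsCentered S A := by
  intro a ha b hb
  have h1 := sum_orders_swap ha hb (ordSign a b)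
  simp only [ordSign_map_swap, Equiv.swap_apply_left, Equiv.swap_apply_right,
    ordSign_swap a b, Finset.sum_neg_distrib] at h1
  rw [h.sum_map]
  linarith

theorem Enumerates.isPairBalanced {S : Finset α} {A : List (List α)}
    (h : Enumerates A (orders S)) : IsPairBalanced S A := by
  have hrows : ∀ r ∈ A, r ∈ orders S := fun r => h.mem_iff.mp
  refine IsPairBalanced.of_distinct hrows
    (three_mul_pairSum_of_symm hrows fun a ha b hb c hc hab hac hbc => ?_)
    fun a ha b hb c hc d hd hab hac had hbc hbd hcd => ?_
  · have h1 := sum_orders_swap ha hb fun r => ordSign a b r * ordSign a c r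
    simp only [ordSign_map_swap, Equiv.swap_apply_left, Equiv.swap_apply_right,
      Equiv.swap_apply_of_ne_of_ne hac.symm hbc.symm] at h1
    rw [pairSum, pairSum, h.sum_map, h.sum_map, ← h1]
  · have h1 := sum_orders_swap ha hb fun r => ordSign a b r * ordSign c d r
    simp only [ordSign_map_swap, Equiv.swap_apply_left, Equiv.swap_apply_right,
      Equiv.swap_apply_of_ne_of_ne hac.symm hbc.symm,
      Equiv.swap_apply_of_ne_of_ne had.symm hbd.symm,
      ordSign_swap a b, neg_mul, Finset.sum_neg_distrib] at h1
    rw [pairSum, h.sum_map]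
    linarith

/-- Under a constraint, reversal pairs the admissible orders with the others. -/
theorem two_mul_sum_filter_precedes {S : Finset α} {i j : α} (hi : i ∈ S) (hj : j ∈ S)
    (hij : i ≠ j) (F : List α → ℤ) (hF : ∀ r ∈ orders S, F r.reverse = F r) :
    2 * ∑ r ∈ (orders S).filter (Precedes i j), F r = ∑ r ∈ orders S, F r := by
  rw [← Finset.sum_filter_add_sum_filter_not (orders S) (Precedes i j), two_mul]
  congr 1
  have hrev : ∀ r ∈ orders S, (Precedes i j r.reverse ↔ ¬ Precedes i j r) := by
    intro r hr
    have hi' := (mem_iff_of_mem_orders hr).mpr hi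
    have hj' := (mem_iff_of_mem_orders hr).mpr hj
    rw [← ordSign_eq_one_iff, ordSign_reverse (nodup_of_mem_orders hr) hi' hj',
      ordSign_eq_pwo hi' hij, pwo]
    split_ifs with h <;> simp [h]
  refine Finset.sum_nbij' List.reverse List.reverse ?_ ?_ (by simp) (by simp) ?_
  · intro r hr
    rw [Finset.mem_filter] at hr ⊢
    rw [reverse_mem_orders, hrev r hr.1]
    exact ⟨hr.1, not_not.mpr hr.2⟩
  · intro r hr
    rw [Finset.mem_filter] at hr ⊢
    rw [reverse_mem_orders, hrev r hr.1]
    exact hr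
  · intro r hr
    exact (hF r (Finset.mem_filter.mp hr).1).symm

/-- Products of two signs are invariant under reversal, and reversal exchanges the admissible and
the inadmissible orders, so the admissible half taken twice has the second moments of all orders.
The length matters too: blocks with and without the constrained pair must carry equal weight. -/
theorem Enumerates.isPairBalanced_append_self {S : Finset α} {i j : α} (hi : i ∈ S) (hj : j ∈ S)
    (hij : i ≠ j) {A : List (List α)}
    (h : Enumerates A ((orders S).filter (Precedes i j))) :
    IsPairBalanced S (A ++ A) ∧ (A ++ A).length = (orders S).card := by
  have hlen : (A ++ A).length = (orders S).card := by
    have := two_mul_sum_filter_precedes hi hj hij (fun _ => 1) fun _ _ => rfl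
    simp only [Finset.sum_const, nsmul_eq_mul, mul_one] at this
    rw [List.length_append, h.length_eq]
    zify
    linarith
  refine ⟨⟨fun r hr => ?_, fun a ha b hb c hc d hd => ?_⟩, hlen⟩
  · simp only [List.mem_append, or_self] at hr
    exact (Finset.mem_filter.mp (h.mem_iff.mp hr)).1
  · have hL : Enumerates (orders S).toList (orders S) := Finset.coe_toList _
    have h1 := hL.isPairBalanced.pairSum_eq a ha b hb c hc d hd
    rw [pairSum, hL.sum_map, hL.length_eq, ← two_mul_sum_filter_precedes hi hj hij, ← h.sum_map]
      at h1
    · rw [hlen, ← h1, pairSum, List.map_append, List.sum_append]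
      ring
    · intro r hr
      have hm : ∀ x ∈ S, x ∈ r := fun x hx => (mem_iff_of_mem_orders hr).mpr hx
      rw [ordSign_reverse (nodup_of_mem_orders hr) (hm a ha) (hm b hb),
        ordSign_reverse (nodup_of_mem_orders hr) (hm c hc) (hm d hd), neg_mul_neg]

/-- Expresses a product of signs by the two patterns with equal signs, whose frequencies are known
for an array of strength 2. -/
theorem pwo_mul_pwo (a b c d : α) (r : List α) :
    pwo a b r * pwo c d r = 2 * (if pwo a b r = 1 ∧ pwo c d r = 1 then 1 else 0) +
      2 * (if pwo a b r = -1 ∧ pwo c d r = -1 then 1 else 0) - 1 := by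
  unfold pwo
  split_ifs <;> simp_all

/-- In an OofA-OA of strength 2 the pairwise product moments are those of the full array. -/
theorem IsOofAOA.sum_pwo_mul_pwo {S : Finset α} {A : List (List α)} (h : IsOofAOA 2 S A)
    {a b c d : α} (ha : a ∈ S) (hb : b ∈ S) (hc : c ∈ S) (hd : d ∈ S) (hab : a < b)
    (hcd : c < d) :
    (A.map fun r => pwo a b r * pwo c d r).sum * (orders S).card =
      A.length * ∑ r ∈ orders S, pwo a b r * pwo c d r := by
  have key := h.2.2 ![(a, b), (c, d)] (by
    intro s
    fin_cases s
    · exact ⟨ha, hb, hab⟩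
    · exact ⟨hc, hd, hcd⟩)
  have h1 := key fun _ => 1
  have h2 := key fun _ => -1
  simp only [Fin.forall_fin_two, Matrix.cons_val_zero, Matrix.cons_val_one] at h1 h2
  zify at h1 h2
  rw [← sum_map_ite] at h1 h2
  simp only [Finset.card_filter] at h1 h2
  push_cast at h1 h2
  have e1 : (A.map fun r => pwo a b r * pwo c d r).sum =
      2 * (A.map fun r => if pwo a b r = 1 ∧ pwo c d r = 1 then (1 : ℤ) else 0).sum +
      2 * (A.map fun r => if pwo a b r = -1 ∧ pwo c d r = -1 then (1 : ℤ) else 0).sum -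
      A.length := by
    rw [← List.sum_map_mul_left, ← List.sum_map_mul_left, ← List.sum_map_add]
    have : (A.length : ℤ) = (A.map fun _ => (1 : ℤ)).sum := by simp
    rw [this, eq_sub_iff_add_eq, ← List.sum_map_add]
    refine congrArg List.sum (List.map_congr_left fun r _ => ?_)
    rw [pwo_mul_pwo]
    ring
  have e2 : ∑ r ∈ orders S, pwo a b r * pwo c d r =
      2 * (∑ r ∈ orders S, if pwo a b r = 1 ∧ pwo c d r = 1 then (1 : ℤ) else 0) +
      2 * (∑ r ∈ orders S, if pwo a b r = -1 ∧ pwo c d r = -1 then (1 : ℤ) else 0) -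
      (orders S).card := by
    rw [Finset.mul_sum, Finset.mul_sum, ← Finset.sum_add_distrib, Finset.card_eq_sum_ones]
    push_cast
    rw [← Finset.sum_sub_distrib]
    exact Finset.sum_congr rfl fun r _ => pwo_mul_pwo a b c d r
  rw [e1, e2]
  linear_combination 2 * h1 + 2 * h2

/-- The strength condition speaks of pairs `i < j` only; antisymmetry carries it to all pairs. -/
theorem IsOofAOA.pairSum_mul_card {S : Finset α} {A : List (List α)} (h : IsOofAOA 2 S A)
    {a b c d : α} (ha : a ∈ S) (hb : b ∈ S) (hc : c ∈ S) (hd : d ∈ S) :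
    pairSum A a b c d * (orders S).card =
      A.length * pairSum (orders S).toList a b c d := by
  have hL : Enumerates (orders S).toList (orders S) := Finset.coe_toList _
  have base : ∀ a ∈ S, ∀ b ∈ S, ∀ c ∈ S, ∀ d ∈ S, a < b → c < d →
      pairSum A a b c d * (orders S).card = A.length * pairSum (orders S).toList a b c d := by
    intro a ha b hb c hc d hd hab hcd
    have h1 := h.sum_pwo_mul_pwo ha hb hc hd hab hcd
    rw [pairSum, pairSum, hL.sum_map]
    have e : ∀ r ∈ orders S, ordSign a b r * ordSign c d r = pwo a b r * pwo c d r := by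
      intro r hr
      rw [ordSign_eq_pwo ((mem_iff_of_mem_orders hr).mpr ha) hab.ne,
        ordSign_eq_pwo ((mem_iff_of_mem_orders hr).mpr hc) hcd.ne]
    rw [Finset.sum_congr rfl e, List.map_congr_left fun r hr => e r (h.2.1 r hr), h1]
  have step : ∀ a ∈ S, ∀ b ∈ S, ∀ c ∈ S, ∀ d ∈ S, a < b →
      pairSum A a b c d * (orders S).card = A.length * pairSum (orders S).toList a b c d := by
    intro a ha b hb c hc d hd hab
    rcases lt_trichotomy c d with hcd | rfl | hcd
    · exact base a ha b hb c hc d hd hab hcd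
    · simp [pairSum]
    · have := base a ha b hb d hd c hc hab hcd
      rw [pairSum_swap_right A, pairSum_swap_right (orders S).toList]
      linarith
  rcases lt_trichotomy a b with hab | rfl | hab
  · exact step a ha b hb c hc d hd hab
  · simp [pairSum]
  · have := step b hb a ha c hc d hd hab
    rw [pairSum_swap_left A, pairSum_swap_left (orders S).toList]
    linarith

theorem IsOofAOA.isPairBalanced {S : Finset α} {A : List (List α)} (h : IsOofAOA 2 S A) :
    IsPairBalanced S A := by
  refine ⟨h.2.1, fun a ha b hb c hc d hd => ?_⟩
  have hL : Enumerates (orders S).toList (orders S) := Finset.coe_toList _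
  have h1 := h.pairSum_mul_card ha hb hc hd
  have h2 := hL.isPairBalanced.pairSum_eq a ha b hb c hc d hd
  rw [hL.length_eq] at h2
  have hpos : ((orders S).card : ℤ) ≠ 0 := by exact_mod_cast (card_orders_pos S).ne'
  refine mul_right_cancel₀ hpos ?_
  linear_combination 3 * h1 + A.length * h2

theorem IsOofAOA.isCentered {S : Finset α} {A : List (List α)} (h : IsOofAOA 2 S A) :
    IsCentered S A := by
  have hL : Enumerates (orders S).toList (orders S) := Finset.coe_toList _
  have base : ∀ a ∈ S, ∀ b ∈ S, a < b → (A.map (ordSign a b)).sum = 0 := by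
    intro a ha b hb hab
    -- Using the same factor twice turns the strength 2 condition into one on single factors.
    have key := h.2.2 (fun _ => (a, b)) (fun _ => ⟨ha, hb, hab⟩) fun _ => 1
    simp only [Fin.forall_fin_two, and_self] at key
    zify at key
    rw [← sum_map_ite, Finset.card_filter] at key
    push_cast at key
    have e : ∀ r ∈ orders S, ordSign a b r = 2 * (if pwo a b r = 1 then 1 else 0) - 1 := by
      intro r hr
      rw [ordSign_eq_pwo ((mem_iff_of_mem_orders hr).mpr ha) hab.ne]
      unfold pwo
      split_ifs <;> simp_all
    have h0 := hL.isCentered a ha b hb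
    rw [hL.sum_map, Finset.sum_congr rfl e, Finset.sum_sub_distrib, ← Finset.mul_sum,
      Finset.sum_const, nsmul_eq_mul, mul_one] at h0
    have hpos : ((orders S).card : ℤ) ≠ 0 := by exact_mod_cast (card_orders_pos S).ne'
    have e1 : (A.map (ordSign a b)).sum =
        2 * (A.map fun r => if pwo a b r = 1 then (1 : ℤ) else 0).sum - A.length := by
      have : (A.length : ℤ) = (A.map fun _ => (1 : ℤ)).sum := by simp
      rw [← List.sum_map_mul_left, this, eq_sub_iff_add_eq, ← List.sum_map_add]
      refine congrArg List.sum (List.map_congr_left fun r hr => ?_)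
      rw [e r (h.2.1 r hr)]
      ring
    refine mul_right_cancel₀ hpos ?_
    rw [e1]
    linear_combination 2 * key + A.length * h0
  intro a ha b hb
  rcases lt_trichotomy a b with hab | rfl | hab
  · exact base a ha b hb hab
  · exact List.sum_eq_zero (by simp)
  · have := base b hb a ha hab
    have e : (A.map (ordSign a b)).sum = (A.map fun r => -1 * ordSign b a r).sum :=
      congrArg List.sum (List.map_congr_left fun r _ => by rw [ordSign_swap b a, neg_one_mul])
    rw [e, List.sum_map_mul_left, this, mul_zero]

theorem sum_blockInd_mul {b : ℕ} (o : Fin b → Finset α) (i j : α) :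
    ∑ l, blockInd (o l) i * blockInd (o l) j = concurrence o i j := by
  rw [concurrence, Finset.card_filter]
  push_cast
  refine Finset.sum_congr rfl fun l _ => ?_
  unfold blockInd
  by_cases hi : i ∈ o l <;> by_cases hj : j ∈ o l <;> simp [hi, hj]

theorem sum_blockInd_mul_self {b : ℕ} (o : Fin b → Finset α) (i : α) :
    ∑ l, blockInd (o l) i * blockInd (o l) i = replication o i := by
  rw [sum_blockInd_mul]
  simp [concurrence, replication]

theorem IsBalancedBlockDesign.two_mul_concurrence {G : Finset α} {k b : ℕ}
    {o : Fin b → Finset α} (ho : IsBalancedBlockDesign G k o) {i j h : α} (hi : i ∈ G)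
    (hj : j ∈ G) (hh : h ∈ G) (hij : i ≠ j) (hih : i ≠ h) (hjh : j ≠ h) :
    2 * ((concurrence o i h : ℤ) - concurrence o j h) = replication o i - replication o j := by
  have := ho.2.2 i hi j hj h hh hij hih hjh
  have h2 : 2 * ((concurrence o i h : ℚ) - concurrence o j h) =
      replication o i - replication o j := by linarith
  exact_mod_cast h2

theorem concurrence_comm {b : ℕ} (o : Fin b → Finset α) (i j : α) :
    concurrence o i j = concurrence o j i := by
  simp only [concurrence, and_comm]

theorem injective_of_card_image {k : ℕ} {f : Fin k → α} {s : Finset α}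
    (hf : Finset.univ.image f = s) (hs : s.card = k) : Function.Injective f := by
  rw [← Set.injOn_univ, ← Finset.coe_univ, ← Finset.card_image_iff, hf, hs]
  simp

theorem IsUnconstrainedBlockArray.properties {G : Finset α} {D : List (List α)}
    (h : IsUnconstrainedBlockArray G D) : D ≠ [] ∧ IsPairBalanced G D ∧ IsCentered G D := by
  obtain ⟨k, k', b, A, A', o, f, f', hk, hkk, hA, hA', hlen, ho, hf, hf', rfl⟩ := h
  have hinj : ∀ l, Function.Injective (f l) := fun l =>
    injective_of_card_image (hf l) (ho.2.1 l).2
  have hinj' : ∀ l, Function.Injective (f' l) := fun l =>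
    injective_of_card_image (hf' l) (by
      rw [Finset.card_sdiff_of_subset (ho.2.1 l).1, (ho.2.1 l).2]
      omega)
  have hB : ∀ l, IsPairBalanced (o l) (A.map (List.map (f l))) := fun l =>
    hf l ▸ hA.isPairBalanced.map (hinj l)
  have hC : ∀ l, IsPairBalanced (G \ o l) (A'.map (List.map (f' l))) := fun l =>
    hf' l ▸ hA'.isPairBalanced.map (hinj' l)
  have hB0 : ∀ l, IsCentered (o l) (A.map (List.map (f l))) := fun l =>
    hf l ▸ hA.isCentered.map (hinj l)
  have hC0 : ∀ l, IsCentered (G \ o l) (A'.map (List.map (f' l))) := fun l =>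
    hf' l ▸ hA'.isCentered.map (hinj' l)
  have hl : ∀ l, (A.map (List.map (f l))).length = (A'.map (List.map (f' l))).length :=
    fun l => by simpa using hlen
  have hApos : 0 < A.length := List.length_pos_iff.mpr hA.1
  simp only [List.ofFn_eq_map]
  refine ⟨?_, ?_, ?_⟩
  · rw [ne_eq, List.flatten_eq_nil_iff]
    push Not
    refine ⟨_, List.mem_map_of_mem (List.mem_finRange (⟨0, ho.1⟩ : Fin b)), ?_⟩
    rw [← List.length_pos_iff]
    simp only [beside, colReverse, List.length_append, List.length_zipWith, List.length_map,
      ← hlen]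
    omega
  · refine IsPairBalanced.flatten_of_blocks _ o _ (2 * A.length) (fun l _ => ⟨?_, ?_⟩) ?_ ?_
    · exact IsBlockBalanced.crossed (ho.2.1 l).1 (hl l) (hB l) (hC l) (hC0 l)
    · simp only [beside, colReverse, List.length_append, List.length_zipWith, List.length_map,
        ← hlen]
      omega
    · intro x hx y hy z hz hxy hxz hyz
      simp only [← Fin.sum_univ_def, sub_mul, mul_sub, Finset.sum_sub_distrib,
        sum_blockInd_mul_self, sum_blockInd_mul]
      -- The two sides are `r_x - λ_xy - λ_xz + λ_yz` and `r_y - λ_xy - λ_yz + λ_xz`; their equality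
      -- is the design equation itself.
      have := ho.two_mul_concurrence hx hy hz hxy hxz hyz
      rw [concurrence_comm o y x]
      linarith
    · intro x hx y hy z hz w hw hxy hxz hxw hyz hyw hzw
      simp only [← Fin.sum_univ_def, sub_mul, mul_sub, Finset.sum_sub_distrib, sum_blockInd_mul]
      -- By the design equation `λ_xh - λ_yh` does not depend on the third component `h`; the two
      -- instances are subtracted.
      have h1 := ho.two_mul_concurrence hx hy hz hxy hxz hyz
      have h2 := ho.two_mul_concurrence hx hy hw hxy hxw hyw
      linarith
  · intro x hx y hy
    rw [List.map_flatten, List.sum_flatten, List.map_map, List.map_map]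
    refine List.sum_eq_zero fun t ht => ?_
    obtain ⟨l, -, rfl⟩ := List.mem_map.mp ht
    exact IsCentered.crossed (hl l) (hB l).mem_orders (hC l).mem_orders (hB0 l) x hx y hy

end Arrays

end OofA

/-! ### Groups with one constraint. -/

namespace OofA

section ConstrainedArrays

variable {α : Type*} [LinearOrder α]

/-- Complementation maps half-sized subsets to half-sized subsets and exchanges those that contain
`i` with the others. It allows the restriction to blocks with `ic` to be dropped, which restores the
symmetry in all components. -/
theorem two_mul_sum_powersetCard_filter_mem {G : Finset α} (hG : Even G.card) {i : α} (hi : i ∈ G)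
    (F : Finset α → ℤ) (hF : ∀ s ⊆ G, F (G \ s) = F s) :
    2 * ∑ s ∈ (G.powersetCard (G.card / 2)).filter (fun s => i ∈ s), F s =
      ∑ s ∈ G.powersetCard (G.card / 2), F s := by
  rw [← Finset.sum_filter_add_sum_filter_not (G.powersetCard (G.card / 2)) (fun s => i ∈ s),
    two_mul]
  congr 1
  have hc : ∀ s ⊆ G, s.card = G.card / 2 → (G \ s).card = G.card / 2 := by
    intro s hs hs'
    obtain ⟨k, hk⟩ := hG
    rw [Finset.card_sdiff_of_subset hs]
    omega
  refine Finset.sum_nbij' (fun s => G \ s) (fun s => G \ s) ?_ ?_ ?_ ?_ ?_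
  · intro s hs
    simp only [Finset.mem_filter, Finset.mem_powersetCard, Finset.mem_sdiff, hi, true_and] at hs ⊢
    exact ⟨⟨Finset.sdiff_subset, hc s hs.1.1 hs.1.2⟩, not_not.mpr hs.2⟩
  · intro s hs
    simp only [Finset.mem_filter, Finset.mem_powersetCard, Finset.mem_sdiff, hi, true_and] at hs ⊢
    exact ⟨⟨Finset.sdiff_subset, hc s hs.1.1 hs.1.2⟩, hs.2⟩
  · intro s hs
    simp only [Finset.mem_filter, Finset.mem_powersetCard] at hs
    exact Finset.sdiff_sdiff_eq_self hs.1.1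
  · intro s hs
    simp only [Finset.mem_filter, Finset.mem_powersetCard] at hs
    exact Finset.sdiff_sdiff_eq_self hs.1.1
  · intro s hs
    simp only [Finset.mem_filter, Finset.mem_powersetCard] at hs
    exact (hF s hs.1.1).symm

theorem sum_powersetCard_swap {G : Finset α} (k : ℕ) {x y : α} (hx : x ∈ G) (hy : y ∈ G)
    (F : Finset α → ℤ) :
    ∑ s ∈ G.powersetCard k, F (s.map (Equiv.swap x y).toEmbedding) =
      ∑ s ∈ G.powersetCard k, F s := by
  have hmem : ∀ s ∈ G.powersetCard k,
      s.map (Equiv.swap x y).toEmbedding ∈ G.powersetCard k := by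
    intro s hs
    rw [Finset.mem_powersetCard] at hs ⊢
    refine ⟨fun a ha => ?_, by rw [Finset.card_map, hs.2]⟩
    rw [Finset.mem_map_equiv, Equiv.symm_swap] at ha
    have := hs.1 ha
    rw [Equiv.swap_apply_def] at this
    split_ifs at this <;> simp_all
  have hinv : ∀ s : Finset α,
      (s.map (Equiv.swap x y).toEmbedding).map (Equiv.swap x y).toEmbedding = s := by
    intro s
    ext a
    simp [Finset.mem_map_equiv]
  exact Finset.sum_nbij' (fun s => s.map (Equiv.swap x y).toEmbedding)
    (fun s => s.map (Equiv.swap x y).toEmbedding) hmem hmem (fun s _ => hinv s)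
    (fun s _ => hinv s) fun _ _ => rfl

theorem blockInd_map_swap (s : Finset α) (x y a : α) :
    blockInd (s.map (Equiv.swap x y).toEmbedding) a = blockInd s (Equiv.swap x y a) := by
  simp only [blockInd, Finset.mem_map_equiv, Equiv.symm_swap]

theorem blockInd_sdiff {G s : Finset α} {a : α} (ha : a ∈ G) :
    blockInd (G \ s) a = 1 - blockInd s a := by
  by_cases h : a ∈ s <;> simp [blockInd, h, ha]

theorem IsEvenConstrainedArray.properties {G : Finset α} {ic jc : α} (hi : ic ∈ G) (hj : jc ∈ G)
    (hij : ic ≠ jc) {D : List (List α)} (h : IsEvenConstrainedArray G ic jc D) :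
    D ≠ [] ∧ IsPairBalanced G D ∧ ∀ r ∈ D, ordSign ic jc r = 1 := by
  obtain ⟨hG, o, B, C, ho, hB, hBc, hC, rfl⟩ := h
  have hmem : ∀ s ∈ o, s ⊆ G ∧ s.card = G.card / 2 ∧ ic ∈ s := by
    intro s hs
    have := ho.mem_iff.mp hs
    rw [Finset.mem_filter, Finset.mem_powersetCard] at this
    exact ⟨this.1.1, this.1.2, this.2⟩
  have hlenC : ∀ s ∈ o, (C s).length = (G.card / 2).factorial := by
    intro s hs
    obtain ⟨hs1, hs2, hs3⟩ := hmem s hs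
    rw [(hC s hs).length_eq, card_orders, Finset.card_sdiff_of_subset hs1, hs2]
    obtain ⟨k, hk⟩ := hG
    congr 1
    omega
  have hBal : ∀ s ∈ o, IsPairBalanced s (B s) ∧ (B s).length = (G.card / 2).factorial := by
    intro s hs
    obtain ⟨hs1, hs2, hs3⟩ := hmem s hs
    by_cases hjs : jc ∈ s
    · obtain ⟨Bc, hBc1, hBc2⟩ := hBc s hs hjs
      have := hBc1.isPairBalanced_append_self hs3 hjs hij
      rw [← hBc2, card_orders, hs2] at this
      exact this
    · rw [(hB s hs hjs).length_eq, card_orders, hs2]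
      exact ⟨(hB s hs hjs).isPairBalanced, rfl⟩
  have hlen : ∀ s ∈ o, (B s).length = (C s).length := fun s hs => by
    rw [(hBal s hs).2, hlenC s hs]
  have hE : ∀ s ∈ o, IsBlockBalanced G s
        (if jc ∈ s then beside (B s) (C s) ++ beside (colReverse (C s)) (B s)
        else beside (B s) (C s) ++ beside (B s) (colReverse (C s))) ∧
      (if jc ∈ s then beside (B s) (C s) ++ beside (colReverse (C s)) (B s)
        else beside (B s) (C s) ++ beside (B s) (colReverse (C s))).length =
        2 * (G.card / 2).factorial := by
    intro s hs
    have hl := hlenC s hs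
    have hl' := (hBal s hs).2
    obtain ⟨hs1, hs2, hs3⟩ := hmem s hs
    split_ifs with hjs
    · refine ⟨IsBlockBalanced.crossed hs1 (hlen s hs) (hBal s hs).1 (hC s hs).isPairBalanced
        (hC s hs).isCentered, ?_⟩
      simp only [beside, colReverse, List.length_append, List.length_zipWith, List.length_map,
        hl, hl', min_self]
      omega
    · refine ⟨IsBlockBalanced.parallel hs1 (hlen s hs) (hBal s hs).1 (hC s hs).isPairBalanced
        (hB s hs hjs).isCentered, ?_⟩
      simp only [beside, colReverse, List.length_append, List.length_zipWith, List.length_map,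
        hl, hl', min_self]
      omega
  have hne : ∃ s, s ∈ o := by
    have hcard : 1 < G.card := Finset.one_lt_card.mpr ⟨ic, hi, jc, hj, hij⟩
    obtain ⟨s, hs1, hs2, hs3⟩ := Finset.exists_subsuperset_card_eq (s := {ic}) (t := G)
      (n := G.card / 2) (by simpa using hi) (by simp; omega) (by omega)
    refine ⟨s, ho.mem_iff.mpr ?_⟩
    rw [Finset.mem_filter, Finset.mem_powersetCard]
    exact ⟨⟨hs2, hs3⟩, hs1 (by simp)⟩
  have hsum : ∀ a ∈ G, ∀ b ∈ G, ∀ c ∈ G, ∀ d ∈ G,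
      2 * (o.map fun s => (blockInd s a - blockInd s b) * (blockInd s c - blockInd s d)).sum =
      ∑ s ∈ G.powersetCard (G.card / 2),
        (blockInd s a - blockInd s b) * (blockInd s c - blockInd s d) := by
    intro a ha b hb c hc d hd
    rw [ho.sum_map]
    -- Passing to the complement changes the sign of both differences, so the product is unchanged.
    refine two_mul_sum_powersetCard_filter_mem hG hi (fun s =>
      (blockInd s a - blockInd s b) * (blockInd s c - blockInd s d)) fun s hs => ?_
    simp only [blockInd_sdiff ha, blockInd_sdiff hb, blockInd_sdiff hc, blockInd_sdiff hd]
    ring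
  refine ⟨?_, ?_, ?_⟩
  · obtain ⟨s, hs⟩ := hne
    rw [ne_eq, List.flatten_eq_nil_iff]
    push Not
    refine ⟨_, List.mem_map_of_mem hs, ?_⟩
    rw [← List.length_pos_iff, (hE s hs).2]
    have := Nat.factorial_pos (G.card / 2)
    omega
  · refine IsPairBalanced.flatten_of_blocks o id _ _ hE ?_ ?_
    · intro a ha b hb c hc hab hac hbc
      simp only [id]
      have h1 := hsum a ha b hb a ha c hc
      have h2 := hsum b hb a ha b hb c hc
      rw [← sum_powersetCard_swap (G.card / 2) ha hb] at h1
      simp only [blockInd_map_swap, Equiv.swap_apply_left, Equiv.swap_apply_right,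
        Equiv.swap_apply_of_ne_of_ne hac.symm hbc.symm] at h1
      linarith
    · intro a ha b hb c hc d hd hab hac had hbc hbd hcd
      simp only [id]
      have h1 := hsum a ha b hb c hc d hd
      have h2 := hsum b hb a ha c hc d hd
      rw [← sum_powersetCard_swap (G.card / 2) ha hb] at h1
      simp only [blockInd_map_swap, Equiv.swap_apply_left, Equiv.swap_apply_right,
        Equiv.swap_apply_of_ne_of_ne hac.symm hbc.symm,
        Equiv.swap_apply_of_ne_of_ne had.symm hbd.symm] at h1
      have h3 : (o.map fun s => (blockInd s b - blockInd s a) *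
            (blockInd s c - blockInd s d)).sum =
          -(o.map fun s => (blockInd s a - blockInd s b) *
            (blockInd s c - blockInd s d)).sum := by
        rw [neg_eq_neg_one_mul, ← List.sum_map_mul_left]
        exact congrArg List.sum (List.map_congr_left fun s _ => by ring)
      linarith
  · intro r hr
    obtain ⟨_, hl, hr⟩ := List.mem_flatten.mp hr
    obtain ⟨s, hs, rfl⟩ := List.mem_map.mp hl
    obtain ⟨hs1, hs2, hs3⟩ := hmem s hs
    have hz := fun p => mem_orders_of_mem_zip (p := p) (hBal s hs).1.mem_orders
      (hC s hs).isPairBalanced.mem_orders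
    split_ifs at hr with hjs
    · rw [beside_eq_map_zip, colReverse_beside_eq_map_zip] at hr
      obtain ⟨Bc, hBc1, hBc2⟩ := hBc s hs hjs
      have hprec : ∀ x ∈ B s, ordSign ic jc x = 1 := by
        intro x hx
        rw [hBc2] at hx
        simp only [List.mem_append, or_self] at hx
        exact ordSign_eq_one_iff.mpr (Finset.mem_filter.mp (hBc1.mem_iff.mp hx)).2
      simp only [List.mem_append, List.mem_map] at hr
      rcases hr with ⟨p, hp, rfl⟩ | ⟨p, hp, rfl⟩
      · rw [ordSign_append_of_mem ((mem_iff_of_mem_orders (hz p hp).1).mpr hs3)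
          ((mem_iff_of_mem_orders (hz p hp).1).mpr hjs)]
        exact hprec _ (List.of_mem_zip hp).1
      · rw [ordSign_append_of_notMem]
        · exact hprec _ (List.of_mem_zip hp).1
        · rw [List.mem_reverse, mem_iff_of_mem_orders (hz p hp).2]
          simp [hs3]
        · rw [List.mem_reverse, mem_iff_of_mem_orders (hz p hp).2]
          simp [hjs]
    · rw [beside_eq_map_zip, beside_colReverse_eq_map_zip] at hr
      simp only [List.mem_append, List.mem_map] at hr
      rcases hr with ⟨p, hp, rfl⟩ | ⟨p, hp, rfl⟩
      all_goals
        rw [ordSign_append_of_mem_of_notMem ((mem_iff_of_mem_orders (hz p hp).1).mpr hs3)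
          fun h => hjs ((mem_iff_of_mem_orders (hz p hp).1).mp h)]

theorem ordSign_insertIdx {a b i : α} (ha : a ≠ i) (hb : b ≠ i) (k : ℕ) (r : List α) :
    ordSign a b (r.insertIdx k i) = ordSign a b r := by
  induction k generalizing r with
  | zero => rw [List.insertIdx_zero, ordSign_cons_of_ne ha hb]
  | succ k ih =>
    cases r with
    | nil => simp
    | cons y r =>
      rw [List.insertIdx_succ_cons]
      by_cases hay : a = y <;> by_cases hby : b = y
      · simp [hay, hby]
      · rw [hay, ordSign_cons_left hby, ordSign_cons_left hby]
      · rw [hby, ordSign_cons_right hay, ordSign_cons_right hay]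
      · rw [ordSign_cons_of_ne hay hby, ordSign_cons_of_ne hay hby, ih]

/-- If `p` components precede `a` among `n`, the inserted component is before `a` in `p + 1`
positions and after it in `n - p`. The difference `2 p + 1 - n` is also the number of components
before `a` minus the number after it. Second moments that involve the new component thus reduce to
sums of old ones. -/
theorem sum_ordSign_insertIdx {i a : α} {r : List α} (hr : r.Nodup) (hi : i ∉ r) (ha : a ∈ r) :
    ∑ k ∈ Finset.range (r.length + 1), ordSign i a (r.insertIdx k i) =
      (r.map fun x => ordSign x a r).sum := by
  induction r with
  | nil => simp at ha
  | cons y r ih =>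
    rw [List.nodup_cons] at hr
    have hiy : i ≠ y := fun h => hi (by simp [h])
    have hai : a ≠ i := fun h => hi (h ▸ ha)
    rw [List.length_cons, Finset.sum_range_succ', List.map_cons, List.sum_cons,
      List.insertIdx_zero, ordSign_cons_left hai]
    simp only [List.insertIdx_succ_cons]
    rcases eq_or_ne a y with rfl | hay
    · have h1 : ∀ x ∈ r, ordSign x a (a :: r) = -1 := fun x hx =>
        ordSign_cons_right fun h => hr.1 (h ▸ hx)
      rw [List.map_congr_left h1, Finset.sum_congr rfl fun k _ => ordSign_cons_right hiy]
      simp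
    · have h1 : ∀ x ∈ r, ordSign x a (y :: r) = ordSign x a r := fun x hx =>
        ordSign_cons_of_ne (fun h => hr.1 (h ▸ hx)) hay
      rw [List.map_congr_left h1, Finset.sum_congr rfl fun k _ => ordSign_cons_of_ne hiy hay,
        ih hr.2 (fun h => hi (List.mem_cons_of_mem _ h)) (by simpa [hay] using ha),
        ordSign_cons_left hay, add_comm]

theorem sum_map_flatten_range {β : Type*} (g : ℕ → β → β) (L : List β) (F : β → ℤ) (q : ℕ) :
    ((((List.range q).map fun k => L.map (g k)).flatten).map F).sum =
      (L.map fun r => ∑ k ∈ Finset.range q, F (g k r)).sum := by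
  induction q with
  | zero => simp
  | succ q ih =>
    simp only [List.range_succ, List.map_append, List.flatten_append, List.sum_append, ih,
      Finset.sum_range_succ, List.sum_map_add]
    simp [Function.comp_def]

theorem IsOddConstrainedArray.properties {G : Finset α} {ic jc : α} (hi : ic ∈ G) (hj : jc ∈ G)
    (hij : ic ≠ jc) {D : List (List α)} (h : IsOddConstrainedArray G ic jc D) :
    D ≠ [] ∧ IsPairBalanced G D ∧ ∀ r ∈ D, ordSign ic jc r = 1 := by
  obtain ⟨hG, i, hiG, hiic, hijc, D₀, hD₀, rfl⟩ := h
  obtain ⟨hne, hbal, hprec⟩ := hD₀.properties (Finset.mem_erase.mpr ⟨hiic.symm, hi⟩)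
    (Finset.mem_erase.mpr ⟨hijc.symm, hj⟩) hij
  have hcard : (G.erase i).card + 1 = G.card := Finset.card_erase_add_one hiG
  have hlen₀ : ∀ r ∈ D₀, r.length + 1 = G.card := fun r hr => by
    rw [length_of_mem_orders (hbal.mem_orders r hr), hcard]
  set D := ((List.range G.card).map fun k => D₀.map fun r => r.insertIdx k i).flatten with hD
  have hlen : (D.length : ℤ) = G.card * D₀.length := by
    have := sum_map_flatten_range (fun k r => List.insertIdx r k i) D₀ (fun _ => 1) G.card
    rw [← hD] at this
    simpa [mul_comm] using this
  have hmemD : ∀ r ∈ D, ∃ k ≤ (G.erase i).card, ∃ s ∈ D₀, s.insertIdx k i = r := by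
    intro r hr
    obtain ⟨_, hl, hr⟩ := List.mem_flatten.mp hr
    obtain ⟨k, hk, rfl⟩ := List.mem_map.mp hl
    obtain ⟨s, hs, rfl⟩ := List.mem_map.mp hr
    rw [List.mem_range] at hk
    exact ⟨k, by omega, s, hs, rfl⟩
  have hnotmem : ∀ r ∈ D₀, i ∉ r := fun r hr h => by
    rw [mem_iff_of_mem_orders (hbal.mem_orders r hr)] at h
    exact Finset.notMem_erase i G h
  have hrows : ∀ r ∈ D, r ∈ orders G := by
    intro r hr
    obtain ⟨k, hk, s, hs, rfl⟩ := hmemD r hr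
    have hs' := hbal.mem_orders s hs
    have hp := List.perm_insertIdx i s (i := k) (by rw [length_of_mem_orders hs']; exact hk)
    refine perm_mem_orders hp.symm (mem_orders_of_nodup
      (List.nodup_cons.mpr ⟨hnotmem s hs, nodup_of_mem_orders hs'⟩) fun a => ?_)
    rw [List.mem_cons, mem_iff_of_mem_orders hs', Finset.mem_erase]
    rcases eq_or_ne a i with rfl | hai
    · simp [hiG]
    · simp [hai]
  have hold : ∀ a ∈ G.erase i, ∀ b ∈ G.erase i, ∀ c ∈ G.erase i, ∀ d ∈ G.erase i,
      3 * pairSum D a b c d = D.length * pairCov a b c d := by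
    intro a ha b hb c hc d hd
    have h1 := hbal.pairSum_eq a ha b hb c hc d hd
    rw [Finset.mem_erase] at ha hb hc hd
    have h2 : pairSum D a b c d = G.card * pairSum D₀ a b c d := by
      rw [pairSum, hD, sum_map_flatten_range (fun k r => List.insertIdx r k i)]
      simp only [ordSign_insertIdx ha.1 hb.1, ordSign_insertIdx hc.1 hd.1, Finset.sum_const,
        Finset.card_range, nsmul_eq_mul]
      rw [List.sum_map_mul_left, pairSum]
    rw [h2, hlen]
    linear_combination (G.card : ℤ) * h1
  have hnew : ∀ a ∈ G.erase i, ∀ b ∈ G.erase i, ∀ c ∈ G.erase i,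
      3 * pairSum D i a b c =
        D.length * ((if a = c then 1 else 0) - (if a = b then 1 else 0)) := by
    intro a ha b hb c hc
    have h2 : pairSum D i a b c = ∑ x ∈ G.erase i, pairSum D₀ x a b c := by
      rw [pairSum, hD, sum_map_flatten_range (fun k r => List.insertIdx r k i)]
      rw [Finset.mem_erase] at hb hc
      have e : ∀ r ∈ D₀, ∑ k ∈ Finset.range G.card,
          ordSign i a (r.insertIdx k i) * ordSign b c (r.insertIdx k i) =
          ∑ x ∈ G.erase i, ordSign x a r * ordSign b c r := by
        intro r hr
        have hr' := hbal.mem_orders r hr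
        simp only [ordSign_insertIdx hb.1 hc.1]
        rw [← Finset.sum_mul, ← Finset.sum_mul, ← hlen₀ r hr,
          sum_ordSign_insertIdx (nodup_of_mem_orders hr') (hnotmem r hr)
            ((mem_iff_of_mem_orders hr').mpr ha),
          Enumerates.sum_map (show Enumerates r (G.erase i) from mem_orders.mp hr')]
      rw [List.map_congr_left e]
      unfold pairSum
      generalize D₀ = L
      induction L with
      | nil => simp
      | cons r L ih => simp [ih, Finset.sum_add_distrib]
    -- The terms in `x` alone cancel, those free of `x` occur `|G| - 1` times, and the mixed
    -- products contribute one more copy. The factor `|G|` matches the number of insertion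
    -- positions.
    have h3 : ∑ x ∈ G.erase i, pairCov x a b c =
        G.card * ((if a = c then 1 else 0) - (if a = b then 1 else 0)) := by
      simp only [pairCov, Finset.sum_sub_distrib, Finset.sum_add_distrib, ← Finset.sum_mul,
        Finset.sum_ite_eq', hb, hc, if_true, Finset.sum_const, nsmul_eq_mul]
      rw [← hcard]
      push_cast
      ring
    rw [h2, Finset.mul_sum, Finset.sum_congr rfl fun x hx => hbal.pairSum_eq x hx a ha b hb c hc,
      ← Finset.mul_sum, h3, hlen]
    ring
  refine ⟨?_, IsPairBalanced.of_distinct hrows ?_ ?_, ?_⟩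
  · rw [← List.length_pos_iff]
    zify
    rw [hlen]
    have h1 : 0 < G.card := by omega
    have h2 : 0 < D₀.length := List.length_pos_iff.mpr hne
    positivity
  · have hmid : ∀ a ∈ G, ∀ c ∈ G, a ≠ i → c ≠ i → a ≠ c →
        3 * pairSum D a i a c = D.length := by
      intro a ha c hc hai hci hac
      have h1 := hnew a (Finset.mem_erase.mpr ⟨hai, ha⟩) a (Finset.mem_erase.mpr ⟨hai, ha⟩)
        c (Finset.mem_erase.mpr ⟨hci, hc⟩)
      rw [if_neg hac, if_pos rfl] at h1
      rw [pairSum_swap_left]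
      linarith
    intro a ha b hb c hc hab hac hbc
    rcases eq_or_ne a i with rfl | hai
    -- When both factors contain the inserted component, the moment is obtained from the other two
    -- moments of the triple.
    · have h1 := pairSum_triple hrows ha hb hab hac hbc
      have h2 := hmid b hb c hc hab.symm hac.symm hbc
      have h3 := hmid c hc b hb hac.symm hab.symm hbc.symm
      linarith
    rcases eq_or_ne b i with rfl | hbi
    · exact hmid a ha c hc hai hbc.symm hac
    rcases eq_or_ne c i with rfl | hci
    · rw [pairSum_comm]
      exact hmid a ha b hb hai hbi hab
    · rw [hold a (Finset.mem_erase.mpr ⟨hai, ha⟩) b (Finset.mem_erase.mpr ⟨hbi, hb⟩)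
        a (Finset.mem_erase.mpr ⟨hai, ha⟩) c (Finset.mem_erase.mpr ⟨hci, hc⟩)]
      simp [pairCov, hab.symm, hac, hbc]
  · have hfirst : ∀ b ∈ G, ∀ c ∈ G, ∀ d ∈ G, b ≠ i → c ≠ i → d ≠ i → b ≠ c → b ≠ d →
        pairSum D i b c d = 0 := by
      intro b hb c hc d hd hbi hci hdi hbc hbd
      have h1 := hnew b (Finset.mem_erase.mpr ⟨hbi, hb⟩) c (Finset.mem_erase.mpr ⟨hci, hc⟩)
        d (Finset.mem_erase.mpr ⟨hdi, hd⟩)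
      rw [if_neg hbc, if_neg hbd] at h1
      linarith
    intro a ha b hb c hc d hd hab hac had hbc hbd hcd
    rcases eq_or_ne a i with rfl | hai
    · exact hfirst b hb c hc d hd hab.symm hac.symm had.symm hbc hbd
    rcases eq_or_ne b i with rfl | hbi
    · rw [pairSum_swap_left, hfirst a ha c hc d hd hai hbc.symm hbd.symm hac had, neg_zero]
    rcases eq_or_ne c i with rfl | hci
    · rw [pairSum_comm]
      exact hfirst d hd a ha b hb hcd.symm hai hbi had.symm hbd.symm
    rcases eq_or_ne d i with rfl | hdi
    · rw [pairSum_swap_right, pairSum_comm, hfirst c hc a ha b hb hci hai hbi hac.symm hbc.symm,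
        neg_zero]
    · have h1 := hold a (Finset.mem_erase.mpr ⟨hai, ha⟩) b (Finset.mem_erase.mpr ⟨hbi, hb⟩)
        c (Finset.mem_erase.mpr ⟨hci, hc⟩) d (Finset.mem_erase.mpr ⟨hdi, hd⟩)
      have h2 : pairCov a b c d = 0 := by simp [pairCov, hac, had, hbc, hbd]
      rw [h2] at h1
      linarith
  · intro r hr
    obtain ⟨k, hk, s, hs, rfl⟩ := hmemD r hr
    rw [ordSign_insertIdx hiic.symm hijc.symm]
    exact hprec s hs

end ConstrainedArrays

end OofA

/-! ### The normal equations of one group. -/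

namespace OofA

section NormalEquations

variable {α : Type*}

/-- Coefficients that solve the normal equations for the PWO factors of one group with the
antisymmetric right-hand side `t`. -/
noncomputable def groupSolution (G : Finset α) (t : α → α → ℝ) (a b : α) : ℝ :=
  3 * t a b - 3 * (∑ c ∈ G, t a c - ∑ c ∈ G, t b c) / (G.card + 1)

theorem sum_sum_antisymm (G : Finset α) (t : α → α → ℝ) (ht : ∀ a b, t b a = -t a b) :
    ∑ a ∈ G, ∑ b ∈ G, t a b = 0 := by
  have h : ∑ a ∈ G, ∑ b ∈ G, t a b = ∑ a ∈ G, ∑ b ∈ G, t b a := Finset.sum_comm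
  have h' : ∑ a ∈ G, ∑ b ∈ G, t b a = -∑ a ∈ G, ∑ b ∈ G, t a b := by
    simp only [← Finset.sum_neg_distrib]
    exact Finset.sum_congr rfl fun a _ => Finset.sum_congr rfl fun b _ => ht a b
  linarith

theorem groupSolution_antisymm (G : Finset α) (t : α → α → ℝ) (ht : ∀ a b, t b a = -t a b)
    (a b : α) : groupSolution G t b a = -groupSolution G t a b := by
  unfold groupSolution
  rw [ht a b]
  ring

/-- For antisymmetric `u` with row sums `U`, the moment operator gives `(U c - U d + u c d) / 3`.
Summing over `d` multiplies row sums by `(|G| + 1) / 3`, which explains the denominator in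
`groupSolution`; this is the converse computation. -/
theorem sum_groupSolution (G : Finset α) (t : α → α → ℝ) (ht : ∀ a b, t b a = -t a b) (c : α) :
    ∑ b ∈ G, groupSolution G t c b = 3 * (∑ b ∈ G, t c b) / (G.card + 1) := by
  have h0 := sum_sum_antisymm G t ht
  unfold groupSolution
  rw [Finset.sum_sub_distrib, ← Finset.mul_sum, ← Finset.sum_div, ← Finset.mul_sum,
    Finset.sum_sub_distrib, h0, Finset.sum_const, nsmul_eq_mul]
  clear ht h0
  field_simp
  ring

variable [LinearOrder α]

theorem groupSolution_spec (G : Finset α) (t : α → α → ℝ) (ht : ∀ a b, t b a = -t a b)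
    {c d : α} (hc : c ∈ G) (hd : d ∈ G) :
    1 / 2 * ∑ a ∈ G, ∑ b ∈ G, groupSolution G t a b * ((pairCov a b c d : ℝ) / 3) = t c d := by
  have hu := groupSolution_antisymm G t ht
  have hU := sum_groupSolution G t ht
  -- Each Kronecker delta in `pairCov` collapses a sum, leaving row sums, column sums and two
  -- entries.
  have key : ∑ a ∈ G, ∑ b ∈ G, groupSolution G t a b * ((pairCov a b c d : ℝ) / 3) =
      (∑ b ∈ G, groupSolution G t c b - ∑ b ∈ G, groupSolution G t d b -
        ∑ a ∈ G, groupSolution G t a c + ∑ a ∈ G, groupSolution G t a d +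
        groupSolution G t c d - groupSolution G t d c) / 3 := by
    have e : ∀ a ∈ G, ∑ b ∈ G, groupSolution G t a b * ((pairCov a b c d : ℝ) / 3) =
        ((if a = c then ∑ b ∈ G, groupSolution G t a b else 0) -
        (if a = d then ∑ b ∈ G, groupSolution G t a b else 0) -
        groupSolution G t a c + groupSolution G t a d +
        (if a = c then groupSolution G t a d else 0) -
        (if a = d then groupSolution G t a c else 0)) / 3 := by
      intro a _
      have e' : ∀ b ∈ G, groupSolution G t a b * ((pairCov a b c d : ℝ) / 3) =
          ((if a = c then groupSolution G t a b else 0) -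
          (if a = d then groupSolution G t a b else 0) -
          (if b = c then groupSolution G t a b else 0) +
          (if b = d then groupSolution G t a b else 0) +
          (if b = d then (if a = c then groupSolution G t a b else 0) else 0) -
          (if b = c then (if a = d then groupSolution G t a b else 0) else 0)) / 3 := by
        intro b _
        unfold pairCov
        push_cast
        simp only [← ite_and, mul_ite, mul_zero, mul_one]
        split_ifs <;> ring
      rw [Finset.sum_congr rfl e', ← Finset.sum_div]
      simp only [Finset.sum_sub_distrib, Finset.sum_add_distrib, Finset.sum_ite_eq', hc, hd,
        if_true]
      split_ifs <;> simp
    rw [Finset.sum_congr rfl e, ← Finset.sum_div]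
    simp only [Finset.sum_sub_distrib, Finset.sum_add_distrib, Finset.sum_ite_eq', hc, hd, if_true]
  rw [key]
  have h1 : ∀ x, ∑ a ∈ G, groupSolution G t a x = -∑ a ∈ G, groupSolution G t x a := fun x => by
    rw [← Finset.sum_neg_distrib]
    exact Finset.sum_congr rfl fun a _ => hu x a
  rw [h1, h1, hu c d, hU, hU, groupSolution]
  ring

theorem ordSign_mul_self_eq {G : Finset α} {r : List α} (hr : ∀ a ∈ G, a ∈ r) {a b : α}
    (ha : a ∈ G) : ordSign a b r * ordSign a b r = 1 - if a = b then 1 else 0 := by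
  by_cases h : a = b
  · simp [h]
  · rw [ordSign_mul_self (hr a ha) h]
    simp [h]

theorem sum_sum_ordSign_mul_self {G : Finset α} {r : List α} (hr : ∀ a ∈ G, a ∈ r) :
    ∑ a ∈ G, ∑ b ∈ G, ordSign a b r * ordSign a b r = (G.card : ℤ) * (G.card - 1) := by
  rw [Finset.sum_congr rfl fun a ha => Finset.sum_congr rfl fun b _ => ordSign_mul_self_eq hr ha]
  simp only [Finset.sum_sub_distrib, Finset.sum_const, nsmul_eq_mul, mul_one, Finset.sum_ite_eq]
  rw [Finset.sum_congr rfl fun a ha => if_pos ha, Finset.sum_const, nsmul_eq_mul]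
  ring

/-- The triple sum is averaged over the three roles of the shared component. By `ordSign_triple`
each triple then contributes 1; this remains true if exactly two entries coincide, and a constant
triple contributes 0. -/
theorem three_mul_sum_sq_sum_ordSign {G : Finset α} {r : List α} (hr : ∀ a ∈ G, a ∈ r) :
    3 * ∑ a ∈ G, (∑ b ∈ G, ordSign a b r) * (∑ b ∈ G, ordSign a b r) =
      (G.card : ℤ) ^ 3 - G.card := by
  have h1 : ∑ a ∈ G, (∑ b ∈ G, ordSign a b r) * (∑ b ∈ G, ordSign a b r) =
      ∑ a ∈ G, ∑ b ∈ G, ∑ c ∈ G, ordSign a b r * ordSign a c r := by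
    simp only [Finset.sum_mul_sum]
  have h2 : ∑ a ∈ G, ∑ b ∈ G, ∑ c ∈ G, ordSign a b r * ordSign a c r =
      ∑ a ∈ G, ∑ b ∈ G, ∑ c ∈ G, ordSign b a r * ordSign b c r := Finset.sum_comm
  have h3 : ∑ a ∈ G, ∑ b ∈ G, ∑ c ∈ G, ordSign a b r * ordSign a c r =
      ∑ a ∈ G, ∑ b ∈ G, ∑ c ∈ G, ordSign c a r * ordSign c b r := by
    rw [Finset.sum_comm]
    conv_rhs => enter [2, a]; rw [Finset.sum_comm]
  have h4 : ∀ a ∈ G, ∀ b ∈ G, ∀ c ∈ G, ordSign a b r * ordSign a c r +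
      ordSign b a r * ordSign b c r + ordSign c a r * ordSign c b r =
      1 - if a = b then (if b = c then 1 else 0) else 0 := by
    intro a ha b hb c hc
    by_cases hab : a = b
    · subst hab
      by_cases hac : a = c
      · subst hac; simp
      · simp [hac, ordSign_mul_self (hr c hc) (Ne.symm hac)]
    · by_cases hac : a = c
      · subst hac
        simp [hab, ordSign_mul_self (hr b hb) (Ne.symm hab)]
      · by_cases hbc : b = c
        · subst hbc
          simp [hab, ordSign_mul_self (hr a ha) hab]
        · rw [ordSign_triple (hr a ha) (hr b hb) hab hac hbc]
          simp [hab]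
  have h5 : ∑ a ∈ G, ∑ b ∈ G, ∑ c ∈ G, (ordSign a b r * ordSign a c r +
      ordSign b a r * ordSign b c r + ordSign c a r * ordSign c b r) =
      (G.card : ℤ) ^ 3 - G.card := by
    rw [Finset.sum_congr rfl fun a ha => Finset.sum_congr rfl fun b hb =>
      Finset.sum_congr rfl fun c hc => h4 a ha b hb c hc]
    simp only [Finset.sum_sub_distrib, Finset.sum_const, nsmul_eq_mul, mul_one]
    have : ∀ a ∈ G, ∑ b ∈ G, ∑ c ∈ G, (if a = b then (if b = c then (1 : ℤ) else 0) else 0) =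
        1 := by
      intro a ha
      rw [Finset.sum_eq_single a]
      · simp [ha]
      · intro b _ hb
        simp [hb.symm]
      · exact fun h => absurd ha h
    rw [Finset.sum_congr rfl this, Finset.sum_const, nsmul_eq_mul]
    ring
  simp only [Finset.sum_add_distrib] at h5
  rw [← h2, ← h3] at h5
  rw [h1]
  linarith

/-- The predictor for the right-hand side given by an order takes the same value at each order. -/
theorem groupSolution_ordSign {G : Finset α} {r : List α} (hr : ∀ a ∈ G, a ∈ r) :
    1 / 2 * ∑ a ∈ G, ∑ b ∈ G,
      groupSolution G (fun x y => (ordSign x y r : ℝ)) a b * (ordSign a b r : ℝ) =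
      (G.card : ℝ) * (G.card - 1) / 2 := by
  have h1 : ∑ a ∈ G, ∑ b ∈ G, (ordSign a b r : ℝ) * ordSign a b r =
      (G.card : ℝ) * (G.card - 1) := by exact_mod_cast sum_sum_ordSign_mul_self hr
  have h2 : 3 * ∑ a ∈ G, (∑ b ∈ G, (ordSign a b r : ℝ)) * (∑ b ∈ G, (ordSign a b r : ℝ)) =
      (G.card : ℝ) ^ 3 - G.card := by exact_mod_cast three_mul_sum_sq_sum_ordSign hr
  set R : α → ℝ := fun a => ∑ b ∈ G, (ordSign a b r : ℝ) with hR
  change 3 * ∑ a ∈ G, R a * R a = _ at h2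
  have e1 : ∑ a ∈ G, ∑ b ∈ G, R a * (ordSign a b r : ℝ) = ∑ a ∈ G, R a * R a :=
    Finset.sum_congr rfl fun a _ => (Finset.mul_sum _ _ _).symm
  have e2 : ∑ a ∈ G, ∑ b ∈ G, R b * (ordSign a b r : ℝ) = -∑ a ∈ G, R a * R a := by
    rw [Finset.sum_comm, ← e1, ← Finset.sum_neg_distrib]
    refine Finset.sum_congr rfl fun b _ => ?_
    rw [← Finset.sum_neg_distrib]
    refine Finset.sum_congr rfl fun a _ => ?_
    rw [ordSign_swap b a]
    push_cast
    ring
  have e3 : ∑ a ∈ G, ∑ b ∈ G,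
      groupSolution G (fun x y => (ordSign x y r : ℝ)) a b * (ordSign a b r : ℝ) =
      3 * ∑ a ∈ G, ∑ b ∈ G, (ordSign a b r : ℝ) * ordSign a b r -
      3 / (G.card + 1) * (∑ a ∈ G, ∑ b ∈ G, R a * (ordSign a b r : ℝ) -
        ∑ a ∈ G, ∑ b ∈ G, R b * (ordSign a b r : ℝ)) := by
    simp only [Finset.mul_sum, ← Finset.sum_sub_distrib]
    refine Finset.sum_congr rfl fun a _ => Finset.sum_congr rfl fun b _ => ?_
    simp only [groupSolution, hR]
    ring
  rw [e3, e1, e2, h1]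
  generalize ∑ a ∈ G, R a * R a = Q at h2
  have hq : (G.card : ℝ) + 1 ≠ 0 := by positivity
  field_simp
  linear_combination -2 * h2

end NormalEquations

/-! ### Concatenations of rows from the groups. -/

section Sections

variable {α : Type*}

/-- Indexing by positions rather than by rows keeps the multiplicities and makes the index set a
product. -/
theorem sum_map_sections_ofFn {β M : Type*} [AddCommMonoid M] {n : ℕ} (L : Fin n → List β)
    (F : List β → M) :
    ((List.ofFn L).sections.map F).sum =
      ∑ p : (∀ g, Fin (L g).length), F (List.ofFn fun g => (L g).get (p g)) := by
  induction n generalizing F with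
  | zero => simp [List.sections]
  | succ n ih =>
    rw [List.ofFn_succ, List.sections, List.map_flatMap, List.flatMap, List.sum_flatten,
      List.map_map]
    have := ih (fun g => L g.succ) fun s => ∑ i : Fin (L 0).length, F ((L 0).get i :: s)
    rw [← (Fin.consEquiv fun g => Fin (L g).length).sum_comp, Fintype.sum_prod_type,
      Finset.sum_comm]
    simp only [List.ofFn_succ, Fin.consEquiv_apply, Fin.cons_zero, Fin.cons_succ]
    rw [← this]
    refine congrArg List.sum (List.map_congr_left fun s _ => ?_)
    simp only [Function.comp_apply, List.map_map]
    rw [← Fin.sum_univ_fun_getElem]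
    rfl

theorem exists_of_mem_sections_ofFn {β : Type*} {n : ℕ} (L : Fin n → List β) {s : List β}
    (hs : s ∈ (List.ofFn L).sections) : ∃ w : Fin n → β, (∀ g, w g ∈ L g) ∧ s = List.ofFn w := by
  induction n generalizing s with
  | zero => exact ⟨Fin.elim0, fun g => g.elim0, by simpa [List.sections] using hs⟩
  | succ n ih =>
    rw [List.ofFn_succ, List.sections, List.mem_flatMap] at hs
    obtain ⟨s', hs', hs⟩ := hs
    obtain ⟨a, ha, rfl⟩ := List.mem_map.mp hs
    obtain ⟨w, hw, rfl⟩ := ih _ hs'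
    refine ⟨Fin.cons a w, fun g => ?_, by simp [List.ofFn_succ]⟩
    refine Fin.cases ?_ (fun g => ?_) g
    · simpa using ha
    · simpa using hw g

variable [LinearOrder α]

theorem ordSign_flatten_ofFn {n : ℕ} (w : Fin n → List α)
    (hw : ∀ g h a, a ∈ w g → a ∈ w h → g = h) {g : Fin n} {a b : α} (ha : a ∈ w g)
    (hb : b ∈ w g) : ordSign a b (List.ofFn w).flatten = ordSign a b (w g) := by
  induction n with
  | zero => exact g.elim0
  | succ n ih =>
    rw [List.ofFn_succ, List.flatten_cons]
    induction g using Fin.cases with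
    | zero => exact ordSign_append_of_mem ha hb
    | succ g =>
      rw [ordSign_append_of_notMem (fun h => Fin.succ_ne_zero _ (hw _ _ _ ha h))
        fun h => Fin.succ_ne_zero _ (hw _ _ _ hb h)]
      exact ih (fun g => w g.succ)
        (fun g h a ha hb => Fin.succ_injective _ (hw _ _ _ ha hb)) ha hb

theorem ordSign_flatten_ofFn_of_lt {n : ℕ} (w : Fin n → List α)
    (hw : ∀ g h a, a ∈ w g → a ∈ w h → g = h) {g h : Fin n} (hgh : g < h) {a b : α}
    (ha : a ∈ w g) (hb : b ∈ w h) : ordSign a b (List.ofFn w).flatten = 1 := by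
  induction n with
  | zero => exact g.elim0
  | succ n ih =>
    rw [List.ofFn_succ, List.flatten_cons]
    induction g using Fin.cases with
    | zero =>
      exact ordSign_append_of_mem_of_notMem ha fun h' => hgh.ne (hw _ _ _ h' hb)
    | succ g =>
      induction h using Fin.cases with
      | zero => exact absurd hgh (by simp)
      | succ h =>
        rw [ordSign_append_of_notMem (fun h' => Fin.succ_ne_zero _ (hw _ _ _ ha h'))
          fun h' => Fin.succ_ne_zero _ (hw _ _ _ hb h')]
        exact ih (fun g => w g.succ)
          (fun g h a ha hb => Fin.succ_injective _ (hw _ _ _ ha hb)) (by simpa using hgh) ha hb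

end Sections

/-! ### Means over the rows of an array. -/

section Mean

/-- The mean of a function over the rows of an array. -/
noncomputable def rowMean {β : Type*} (D : List β) : (β → ℝ) →ₗ[ℝ] ℝ where
  toFun F := (D.map F).sum / D.length
  map_add' F F' := by
    change (D.map fun r => F r + F' r).sum / _ = _
    rw [List.sum_map_add, add_div]
  map_smul' c F := by
    change (D.map fun r => c * F r).sum / _ = _
    rw [List.sum_map_mul_left, mul_div_assoc]
    rfl

theorem rowMean_apply {β : Type*} (D : List β) (F : β → ℝ) :
    rowMean D F = (D.map F).sum / D.length := rfl

theorem rowMean_congr {β : Type*} {D : List β} {F F' : β → ℝ} (h : ∀ r ∈ D, F r = F' r) :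
    rowMean D F = rowMean D F' := by
  rw [rowMean_apply, rowMean_apply, List.map_congr_left h]

theorem rowMean_one {β : Type*} {D : List β} (hD : D ≠ []) : rowMean D (1 : β → ℝ) = 1 := by
  have : (D.length : ℝ) ≠ 0 := by
    exact_mod_cast (List.length_pos_iff.mpr hD).ne'
  change (D.map fun _ => (1 : ℝ)).sum / _ = 1
  simp [this]

theorem rowMean_intCast {β : Type*} (D : List β) (F : β → ℤ) :
    rowMean D (fun r => (F r : ℝ)) = ((D.map F).sum : ℤ) / D.length := by
  rw [rowMean_apply]
  congr 1
  induction D with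
  | nil => simp
  | cons r D ih => simp [ih]

/-- Under the uniform distribution on the rows of `D` the group parts are independent, so the mean
of a product with one factor per group is the product of the means. -/
theorem rowMean_sections_prod {α : Type*} {n : ℕ} (L : Fin n → List (List α))
    {D : List (List α)} (hD : D.Perm ((List.ofFn L).sections.map List.flatten))
    (φ : Fin n → List α → ℝ) (H : List α → ℝ)
    (hH : ∀ w : Fin n → List α, (∀ g, w g ∈ L g) →
      H (List.ofFn w).flatten = ∏ g, φ g (w g)) :
    rowMean D H = ∏ g, rowMean (L g) (φ g) := by
  have hsum : ∀ F : List α → ℝ, (D.map F).sum =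
      ∑ p : (∀ g, Fin (L g).length), F (List.ofFn fun g => (L g).get (p g)).flatten := by
    intro F
    rw [(hD.map F).sum_eq, List.map_map, sum_map_sections_ofFn]
    rfl
  have hlen : (D.length : ℝ) = ∏ g, ((L g).length : ℝ) := by
    have := hsum fun _ => 1
    simp only [List.map_const', List.sum_replicate, nsmul_eq_mul, mul_one, Finset.sum_const,
      Finset.card_univ, Fintype.card_pi, Fintype.card_fin] at this
    rw [this]
    push_cast
    rfl
  have hprod : ∀ p : (∀ g, Fin (L g).length),
      H (List.ofFn fun g => (L g).get (p g)).flatten = ∏ g, φ g ((L g).get (p g)) :=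
    fun p => hH _ fun g => List.get_mem _ _
  rw [rowMean_apply, hsum, hlen, Finset.sum_congr rfl fun p _ => hprod p]
  simp only [rowMean_apply]
  rw [Finset.prod_div_distrib]
  congr 1
  rw [← Fintype.piFinset_univ, ← Finset.prod_univ_sum (fun g => Finset.univ)
    fun g i => φ g ((L g).get i)]
  refine Finset.prod_congr rfl fun g _ => ?_
  rw [← Fin.sum_univ_fun_getElem]
  rfl

theorem rowMean_sections {α : Type*} {n : ℕ} {L : Fin n → List (List α)}
    (hne : ∀ g, L g ≠ [])
    {D : List (List α)} (hD : D.Perm ((List.ofFn L).sections.map List.flatten))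
    (g : Fin n) (φ H : List α → ℝ)
    (hH : ∀ w : Fin n → List α, (∀ g, w g ∈ L g) → H (List.ofFn w).flatten = φ (w g)) :
    rowMean D H = rowMean (L g) φ := by
  rw [rowMean_sections_prod L hD (fun h => if h = g then φ else 1) H, Finset.prod_eq_single g]
  · simp
  · intro h _ hh
    simp only [hh, if_false, rowMean_one (hne h)]
  · simp
  · intro w hw
    rw [hH w hw, Finset.prod_eq_single g]
    · simp
    · intro h _ hh
      simp [hh]
    · simp

theorem rowMean_sections_mul {α : Type*} {n : ℕ} {L : Fin n → List (List α)}
    (hne : ∀ g, L g ≠ [])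
    {D : List (List α)} (hD : D.Perm ((List.ofFn L).sections.map List.flatten))
    {g g' : Fin n} (hg : g ≠ g') (φ φ' H : List α → ℝ)
    (hH : ∀ w : Fin n → List α, (∀ g, w g ∈ L g) →
      H (List.ofFn w).flatten = φ (w g) * φ' (w g')) :
    rowMean D H = rowMean (L g) φ * rowMean (L g') φ' := by
  rw [rowMean_sections_prod L hD (fun h => if h = g then φ else if h = g' then φ' else 1) H,
    Finset.prod_eq_mul g g' hg]
  · simp [hg.symm]
  · intro h _ hh
    simp only [hh.1, hh.2, if_false, rowMean_one (hne h)]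
  · simp
  · simp
  · intro w hw
    rw [hH w hw, Finset.prod_eq_mul g g' hg]
    · simp [hg.symm]
    · intro h _ hh
      simp [hh.1, hh.2]
    · simp
    · simp

/-- The moments of the design measure of an array are means over its rows. -/
theorem sum_runProportion_mul {m : ℕ} {S : Finset (List (Fin m))} {D : List (List (Fin m))}
    (hD : ∀ r ∈ D, r ∈ S) (F : List (Fin m) → ℝ) :
    ∑ r ∈ S, runProportion D r * F r = rowMean D F := by
  have key : ∑ r ∈ S, (D.count r : ℝ) * F r = (D.map F).sum := by
    induction D with
    | nil => simp
    | cons a D ih =>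
      have ha : a ∈ S := hD a (by simp)
      simp only [List.count_cons, Nat.cast_add, add_mul, Finset.sum_add_distrib, List.map_cons,
        List.sum_cons, ih fun r hr => hD r (List.mem_cons_of_mem _ hr)]
      rw [Finset.sum_eq_single a]
      · simp [add_comm]
      · intro b _ hb
        simp [hb.symm]
      · exact fun h => absurd ha h
  rw [rowMean_apply, ← key, Finset.sum_div]
  refine Finset.sum_congr rfl fun r _ => ?_
  rw [runProportion]
  ring

end Mean

end OofA

namespace OofA

/-! ### The moment matrix of the whole design. -/

namespace MixedProblem

variable {m n : ℕ} (P : MixedProblem m n)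

theorem mem_group {g : Fin n} {a : Fin m} : a ∈ P.group g ↔ P.groupOf a = g := by
  simp [group]

theorem precedes_of_mem_constraints {r : List (Fin m)} (hr : r ∈ P.feasible) {a b : Fin m}
    (h : (a, b) ∈ P.constraints) : Precedes a b r :=
  (Finset.mem_filter.mp hr).2 _ h

theorem mem_of_feasible {r : List (Fin m)} (hr : r ∈ P.feasible) (a : Fin m) : a ∈ r :=
  (mem_iff_of_mem_orders (Finset.mem_filter.mp hr).1).mpr (Finset.mem_univ a)

theorem mem_constraints {a b : Fin m} :
    (a, b) ∈ P.constraints ↔ P.groupOf a < P.groupOf b ∨ ∃ g, (a, b) ∈ P.within g := by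
  simp [constraints]

theorem groupOf_eq_of_notMem_constraints {a b : Fin m} (h : (a, b) ∉ P.constraints)
    (h' : (b, a) ∉ P.constraints) : P.groupOf a = P.groupOf b := by
  rw [mem_constraints, not_or] at h h'
  exact le_antisymm (not_lt.mp h'.1) (not_lt.mp h.1)

theorem within_eq_empty_or_singleton (g : Fin n) :
    P.within g = ∅ ∨ ∃ i j, P.within g = {(i, j)} := by
  rcases Nat.le_one_iff_eq_zero_or_eq_one.mp (P.within_card_le_one g) with h | h
  · exact Or.inl (Finset.card_eq_zero.mp h)
  · obtain ⟨x, hx⟩ := Finset.card_eq_one.mp h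
    exact Or.inr ⟨x.1, x.2, hx⟩

/-- The coordinate of a model vector at a pair that is in the model in the given direction. -/
noncomputable def modelCoord (w : Option P.ModelPair → ℝ) (a b : Fin m) : ℝ :=
  open Classical in
  if h : a < b ∧ (a, b) ∉ P.constraints ∧ (b, a) ∉ P.constraints then w (some ⟨(a, b), h⟩) else 0

/-- The antisymmetric extension of a model vector to all pairs, where constrained pairs get the
coordinate of the constant term. -/
noncomputable def pairExtension (w : Option P.ModelPair → ℝ) (a b : Fin m) : ℝ :=
  P.modelCoord w a b - P.modelCoord w b a +
    ((if (a, b) ∈ P.constraints then 1 else 0) - (if (b, a) ∈ P.constraints then 1 else 0)) *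
      w none

theorem pairExtension_antisymm (w : Option P.ModelPair → ℝ) (a b : Fin m) :
    P.pairExtension w b a = -P.pairExtension w a b := by
  unfold pairExtension
  ring

theorem pairExtension_modelPair (w : Option P.ModelPair → ℝ) (p : P.ModelPair) :
    P.pairExtension w p.1.1 p.1.2 = w (some p) := by
  obtain ⟨⟨a, b⟩, h⟩ := p
  have h1 : P.modelCoord w a b = w (some ⟨(a, b), h⟩) := dif_pos h
  have h2 : P.modelCoord w b a = 0 := dif_neg fun h' => absurd h'.1 h.1.not_gt
  have h3 : (b, a) ∉ P.constraints := h.2.2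
  simp [pairExtension, h1, h2, h.2.1, h3]

/-- A feasible order serves only to exclude that the reversed pair is a constraint as well. -/
theorem pairExtension_constraint (hne : P.feasible.Nonempty) (w : Option P.ModelPair → ℝ)
    {a b : Fin m} (h : (a, b) ∈ P.constraints) : P.pairExtension w a b = w none := by
  have h1 : P.modelCoord w a b = 0 := dif_neg fun h' => h'.2.1 h
  have h2 : P.modelCoord w b a = 0 := dif_neg fun h' => h'.2.2 h
  have h3 : (b, a) ∉ P.constraints := fun h' => by
    obtain ⟨r, hr⟩ := hne
    exact lt_asymm (P.precedes_of_mem_constraints hr h) (P.precedes_of_mem_constraints hr h')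
  simp [pairExtension, h1, h2, h, h3]

theorem expansion_some {r : List (Fin m)} (hr : r ∈ P.feasible) (p : P.ModelPair) :
    P.expansion r (some p) = (ordSign p.1.1 p.1.2 r : ℝ) := by
  rw [ordSign_eq_pwo (P.mem_of_feasible hr _) p.2.1.ne]
  rfl

theorem pairExtension_expansion {r : List (Fin m)} (hr : r ∈ P.feasible) (a b : Fin m) :
    P.pairExtension (P.expansion r) a b = (ordSign a b r : ℝ) := by
  by_cases h1 : (a, b) ∈ P.constraints
  · rw [P.pairExtension_constraint ⟨r, hr⟩ _ h1,
      ordSign_eq_one_iff.mpr (P.precedes_of_mem_constraints hr h1)]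
    simp [expansion]
  by_cases h2 : (b, a) ∈ P.constraints
  · rw [pairExtension_antisymm, P.pairExtension_constraint ⟨r, hr⟩ _ h2, ordSign_swap b a,
      ordSign_eq_one_iff.mpr (P.precedes_of_mem_constraints hr h2)]
    simp [expansion]
  rcases lt_trichotomy a b with hab | rfl | hab
  · exact (P.pairExtension_modelPair _ ⟨(a, b), hab, h1, h2⟩).trans (P.expansion_some hr _)
  · simp [pairExtension]
  · rw [pairExtension_antisymm, ordSign_swap b a, Int.cast_neg, neg_inj]
    exact (P.pairExtension_modelPair _ ⟨(b, a), hab, h2, h1⟩).trans (P.expansion_some hr _)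

/-- The functions of an order that agree on the feasible set with a linear predictor. -/
def predictors : Submodule ℝ (List (Fin m) → ℝ) where
  carrier := {F | ∃ c, ∀ r ∈ P.feasible, P.expansion r ⬝ᵥ c = F r}
  add_mem' := by
    rintro F F' ⟨c, hc⟩ ⟨c', hc'⟩
    exact ⟨c + c', fun r hr => by rw [dotProduct_add, hc r hr, hc' r hr]; rfl⟩
  zero_mem' := ⟨0, fun r _ => by simp⟩
  smul_mem' := by
    rintro a F ⟨c, hc⟩
    exact ⟨a • c, fun r hr => by rw [dotProduct_smul, hc r hr]; rfl⟩

theorem one_mem_predictors : (1 : List (Fin m) → ℝ) ∈ P.predictors :=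
  ⟨Pi.single none 1, fun r _ => by simp [expansion]⟩

/-- The real-valued PWO factor of a pair as a function of the order. -/
def signFun (a b : Fin m) : List (Fin m) → ℝ := fun r => (ordSign a b r : ℝ)

theorem signFun_mem_predictors (a b : Fin m) : signFun a b ∈ P.predictors := by
  have base : ∀ a b : Fin m, a < b → signFun a b ∈ P.predictors := by
    intro a b hab
    by_cases h1 : (a, b) ∈ P.constraints
    · refine ⟨Pi.single none 1, fun r hr => ?_⟩
      simp [expansion, signFun, ordSign_eq_one_iff.mpr (P.precedes_of_mem_constraints hr h1)]
    by_cases h2 : (b, a) ∈ P.constraints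
    · refine ⟨Pi.single none (-1), fun r hr => ?_⟩
      simp [expansion, signFun, ordSign_swap b a,
        ordSign_eq_one_iff.mpr (P.precedes_of_mem_constraints hr h2)]
    · refine ⟨Pi.single (some ⟨(a, b), hab, h1, h2⟩) 1, fun r hr => ?_⟩
      rw [dotProduct_single, mul_one, P.expansion_some hr]
      rfl
  rcases lt_trichotomy a b with hab | rfl | hab
  · exact base a b hab
  · convert P.predictors.zero_mem
    ext r
    simp [signFun]
  · convert P.predictors.neg_mem (base b a hab)
    ext r
    simp [signFun, ordSign_swap b a]

/-- The part of the predictor that belongs to one group. -/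
noncomputable def groupPredictor (w : Option P.ModelPair → ℝ) (g : Fin n) :
    List (Fin m) → ℝ :=
  (1 / 2 : ℝ) • ∑ a ∈ P.group g, ∑ b ∈ P.group g,
    groupSolution (P.group g) (P.pairExtension w) a b • signFun a b

/-- The number of constraints within a group. -/
def constraintCount (g : Fin n) : ℝ := (P.within g).card

/-- The predictor that solves the normal equations for the right-hand side `w`. -/
noncomputable def predictor (w : Option P.ModelPair → ℝ) : List (Fin m) → ℝ :=
  w none • 1 + ∑ g, (P.groupPredictor w g - (P.constraintCount g * w none) • 1)

theorem predictor_mem_predictors (w : Option P.ModelPair → ℝ) :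
    P.predictor w ∈ P.predictors := by
  refine add_mem (P.predictors.smul_mem _ P.one_mem_predictors)
    (sum_mem fun g _ => sub_mem (P.predictors.smul_mem _ ?_)
      (P.predictors.smul_mem _ P.one_mem_predictors))
  exact sum_mem fun a _ => sum_mem fun b _ =>
    P.predictors.smul_mem _ (P.signFun_mem_predictors a b)

/-- At a feasible order the extension of `x(π)` is the full sign matrix, so `groupSolution_ordSign`
applies to each group; the value does not depend on `r`. -/
theorem predictor_expansion {r : List (Fin m)} (hr : r ∈ P.feasible) :
    P.predictor (P.expansion r) r =
      1 + ∑ g, (((P.group g).card : ℝ) * ((P.group g).card - 1) / 2 - P.constraintCount g) := by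
  have hext : P.pairExtension (P.expansion r) = fun a b => (ordSign a b r : ℝ) := by
    ext a b
    exact P.pairExtension_expansion hr a b
  have h : ∀ g, P.groupPredictor (P.expansion r) g r =
      ((P.group g).card : ℝ) * ((P.group g).card - 1) / 2 := by
    intro g
    rw [← groupSolution_ordSign (G := P.group g) (r := r) fun a _ => P.mem_of_feasible hr a]
    simp [groupPredictor, hext, signFun]
  simp [predictor, h, expansion]

/-- The moments that the construction gives to an array of feasible orders. -/
structure HasProductMoments (D : List (List (Fin m))) : Prop where
  ne_nil : D ≠ []
  feasible : ∀ r ∈ D, r ∈ P.feasible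
  within_group : ∀ g, ∀ a ∈ P.group g, ∀ b ∈ P.group g, ∀ c ∈ P.group g, ∀ d ∈ P.group g,
    rowMean D (signFun a b * signFun c d) = (pairCov a b c d : ℝ) / 3
  between_groups : ∀ g h, g ≠ h → ∀ a ∈ P.group g, ∀ b ∈ P.group g, ∀ c ∈ P.group h,
    ∀ d ∈ P.group h,
    rowMean D (signFun a b * signFun c d) = rowMean D (signFun a b) * rowMean D (signFun c d)
  centered : ∀ g, P.within g = ∅ → ∀ a ∈ P.group g, ∀ b ∈ P.group g,
    rowMean D (signFun a b) = 0

namespace HasProductMoments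

variable {P} {D : List (List (Fin m))} (hD : P.HasProductMoments D)

include hD

theorem feasible_nonempty : P.feasible.Nonempty := by
  obtain ⟨r, hr⟩ := List.exists_mem_of_ne_nil D hD.ne_nil
  exact ⟨r, hD.feasible r hr⟩

theorem rowMean_groupPredictor (w : Option P.ModelPair → ℝ) (g : Fin n) :
    rowMean D (P.groupPredictor w g) = P.constraintCount g * w none := by
  simp only [groupPredictor, map_smul, map_sum, smul_eq_mul]
  rcases P.within_eq_empty_or_singleton g with h | ⟨i, j, h⟩
  · rw [Finset.sum_congr rfl fun a ha => Finset.sum_congr rfl fun b hb => by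
      rw [hD.centered g h a ha b hb]]
    simp [constraintCount, h]
  · have hij : (i, j) ∈ P.within g := by simp [h]
    have hmem := P.within_mem g (i, j) hij
    have hcon : (i, j) ∈ P.constraints := P.mem_constraints.mpr (Or.inr ⟨g, hij⟩)
    have hi : i ∈ P.group g := P.mem_group.mpr hmem.1
    have hj : j ∈ P.group g := P.mem_group.mpr hmem.2.1
    -- The sign of `(i, j)` is 1 on all rows, so a first moment is a second moment with that sign.
    -- The mean is then the group's normal equation at `(i, j)`, where the right-hand side is `w
    -- none`.
    have e : ∀ a ∈ P.group g, ∀ b ∈ P.group g,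
        rowMean D (signFun a b) = (pairCov a b i j : ℝ) / 3 := by
      intro a ha b hb
      rw [← hD.within_group g a ha b hb i hi j hj]
      refine rowMean_congr fun r hr => ?_
      simp [signFun, ordSign_eq_one_iff.mpr
        (P.precedes_of_mem_constraints (hD.feasible r hr) hcon)]
    rw [Finset.sum_congr rfl fun a ha => Finset.sum_congr rfl fun b hb => by
      rw [e a ha b hb], groupSolution_spec _ _ (P.pairExtension_antisymm w) hi hj,
      P.pairExtension_constraint hD.feasible_nonempty w hcon]
    simp [constraintCount, h]

theorem rowMean_signFun_mul_groupPredictor (w : Option P.ModelPair → ℝ) {g : Fin n}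
    {c d : Fin m} (hc : c ∈ P.group g) (hd : d ∈ P.group g) :
    rowMean D (signFun c d * P.groupPredictor w g) = P.pairExtension w c d := by
  rw [groupPredictor, mul_smul_comm, mul_comm]
  simp only [Finset.sum_mul, smul_mul_assoc, map_smul, map_sum, smul_eq_mul]
  rw [Finset.sum_congr rfl fun a ha => Finset.sum_congr rfl fun b hb => by
    rw [hD.within_group g a ha b hb c hc d hd],
    groupSolution_spec _ _ (P.pairExtension_antisymm w) hc hd]

theorem rowMean_signFun_mul_groupPredictor_of_ne (w : Option P.ModelPair → ℝ) {g h : Fin n}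
    (hgh : g ≠ h) {c d : Fin m} (hc : c ∈ P.group h) (hd : d ∈ P.group h) :
    rowMean D (signFun c d * P.groupPredictor w g) =
      P.constraintCount g * w none * rowMean D (signFun c d) := by
  rw [← hD.rowMean_groupPredictor w g, groupPredictor, mul_smul_comm, mul_comm]
  simp only [Finset.sum_mul, smul_mul_assoc, map_smul, map_sum, smul_eq_mul]
  rw [Finset.sum_congr rfl fun a ha => Finset.sum_congr rfl fun b hb => by
    rw [hD.between_groups g h hgh a ha b hb c hc d hd, ← mul_assoc]]
  simp only [← Finset.sum_mul]
  ring

/-- This is the normal equation of the constant term: the multiples of 1 subtracted in `predictor`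
are the means of the group predictors. -/
theorem rowMean_predictor (w : Option P.ModelPair → ℝ) : rowMean D (P.predictor w) = w none := by
  simp only [predictor, map_add, map_sum, map_sub, map_smul, rowMean_one hD.ne_nil,
    hD.rowMean_groupPredictor, smul_eq_mul, mul_one, sub_self, Finset.sum_const_zero, add_zero]

theorem rowMean_signFun_mul_predictor (w : Option P.ModelPair → ℝ) (p : P.ModelPair) :
    rowMean D (signFun p.1.1 p.1.2 * P.predictor w) = w (some p) := by
  obtain ⟨⟨c, d⟩, hp⟩ := p
  set h := P.groupOf c with hh
  have hc : c ∈ P.group h := P.mem_group.mpr rfl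
  have hd : d ∈ P.group h :=
    P.mem_group.mpr (P.groupOf_eq_of_notMem_constraints hp.2.1 hp.2.2).symm
  -- A predictor of another group, reduced by its mean, is uncorrelated with the sign of `(c, d)`.
  have hterm : ∀ g, g ≠ h → rowMean D (signFun c d * (P.groupPredictor w g -
      (P.constraintCount g * w none) • 1)) = 0 := by
    intro g hg
    rw [mul_sub, map_sub, hD.rowMean_signFun_mul_groupPredictor_of_ne w hg hc hd,
      mul_smul_comm, mul_one, map_smul, smul_eq_mul, sub_self]
  -- The constants left over contribute `w none` times this quantity: without a constraint the mean
  -- is 0, with one the count is 1.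
  have hmean : rowMean D (signFun c d) * (1 - P.constraintCount h) = 0 := by
    rcases P.within_eq_empty_or_singleton h with h' | ⟨i, j, h'⟩
    · rw [hD.centered h h' c hc d hd, zero_mul]
    · simp [constraintCount, h']
  rw [← P.pairExtension_modelPair w, predictor, mul_add, map_add, Finset.mul_sum, map_sum,
    Finset.sum_eq_single h (fun g _ hg => hterm g hg) (by simp), mul_smul_comm, mul_one, map_smul,
    mul_sub, map_sub, hD.rowMean_signFun_mul_groupPredictor w hc hd, mul_smul_comm, mul_one,
    map_smul, smul_eq_mul, smul_eq_mul]
  linear_combination w none * hmean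

theorem isDesignMeasure : P.IsDesignMeasure (runProportion D) := by
  refine ⟨fun r _ => by unfold runProportion; positivity, ?_⟩
  have := sum_runProportion_mul hD.feasible 1
  rw [rowMean_one hD.ne_nil] at this
  simpa using this

theorem optimal : P.IsDOptimal (runProportion D) ∧ P.IsGOptimal (runProportion D) := by
  -- The sums over ordered pairs contain diagonal, repeated and constrained pairs; this selects
  -- coefficients on the model's own index set that give the same function on feasible orders.
  choose c hc using P.predictor_mem_predictors
  refine P.isDOptimal_and_isGOptimal_of_solution hD.isDesignMeasure c (fun w => ?_) _
    fun r hr => (hc _ r hr).trans (P.predictor_expansion hr)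
  ext k
  rw [moment_mulVec, sum_runProportion_mul hD.feasible fun r =>
    P.expansion r k * (P.expansion r ⬝ᵥ c w)]
  cases k with
  | none =>
    rw [← hD.rowMean_predictor w]
    refine rowMean_congr fun r hr => ?_
    rw [hc w r (hD.feasible r hr)]
    simp [expansion]
  | some p =>
    rw [← hD.rowMean_signFun_mul_predictor w p]
    refine rowMean_congr fun r hr => ?_
    rw [hc w r (hD.feasible r hr), P.expansion_some (hD.feasible r hr)]
    rfl

end HasProductMoments

theorem hasProductMoments_of_groups {D : List (List (Fin m))} {Dg : Fin n → List (List (Fin m))}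
    (hne : ∀ g, Dg g ≠ []) (hbal : ∀ g, IsPairBalanced (P.group g) (Dg g))
    (hcen : ∀ g, P.within g = ∅ → IsCentered (P.group g) (Dg g))
    (hcon : ∀ g i j, P.within g = {(i, j)} → ∀ r ∈ Dg g, ordSign i j r = 1)
    (hD : D.Perm ((List.ofFn Dg).sections.map List.flatten)) : P.HasProductMoments D := by
  have hmem : ∀ w : Fin n → List (Fin m), (∀ g, w g ∈ Dg g) → ∀ g a, a ∈ w g ↔ a ∈ P.group g :=
    fun w hw g a => mem_iff_of_mem_orders ((hbal g).mem_orders _ (hw g))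
  have hdisj : ∀ w : Fin n → List (Fin m), (∀ g, w g ∈ Dg g) →
      ∀ g h a, a ∈ w g → a ∈ w h → g = h := by
    intro w hw g h a hg hh
    rw [hmem w hw, mem_group] at hg hh
    rw [← hg, hh]
  have hsign : ∀ g, ∀ a ∈ P.group g, ∀ b ∈ P.group g, ∀ w : Fin n → List (Fin m),
      (∀ g, w g ∈ Dg g) → signFun a b (List.ofFn w).flatten = signFun a b (w g) := by
    intro g a ha b hb w hw
    unfold signFun
    rw [ordSign_flatten_ofFn w (hdisj w hw) ((hmem w hw g a).mpr ha) ((hmem w hw g b).mpr hb)]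
  have hlen : ∀ g, ((Dg g).length : ℝ) ≠ 0 := fun g => by
    exact_mod_cast (List.length_pos_iff.mpr (hne g)).ne'
  have hmean : ∀ g, ∀ a ∈ P.group g, ∀ b ∈ P.group g,
      rowMean D (signFun a b) = rowMean (Dg g) (signFun a b) := fun g a ha b hb =>
    rowMean_sections hne hD g _ _ (hsign g a ha b hb)
  refine ⟨?_, ?_, ?_, ?_, ?_⟩
  · rintro rfl
    -- The mean over an empty array is 0 by the convention for division by zero, whereas the product
    -- of the group means of 1 is 1.
    have h := rowMean_sections_prod Dg hD (fun _ => 1) (fun _ => 1) (by simp)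
    simp only [show (fun _ : List (Fin m) => (1 : ℝ)) = 1 from rfl, rowMean_one (hne _)] at h
    simp [rowMean_apply] at h
  · intro r hr
    obtain ⟨s, hs, rfl⟩ := List.mem_map.mp (hD.mem_iff.mp hr)
    obtain ⟨w, hw, rfl⟩ := exists_of_mem_sections_ofFn Dg hs
    rw [MixedProblem.feasible, Finset.mem_filter]
    refine ⟨mem_orders_of_nodup ?_ fun a => ?_, ?_⟩
    · rw [List.nodup_flatten, List.pairwise_ofFn]
      refine ⟨fun l hl => ?_, fun g h hgh a ha ha' => ?_⟩
      · obtain ⟨g, rfl⟩ := (List.mem_ofFn' _ _).mp hl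
        exact nodup_of_mem_orders ((hbal g).mem_orders _ (hw g))
      · exact hgh.ne (hdisj w hw g h a ha ha')
    · simp only [Finset.mem_univ, iff_true, List.mem_flatten]
      exact ⟨w (P.groupOf a), (List.mem_ofFn' _ _).mpr ⟨_, rfl⟩,
        (hmem w hw _ a).mpr (P.mem_group.mpr rfl)⟩
    · rintro ⟨a, b⟩ hab
      rw [← ordSign_eq_one_iff]
      rcases P.mem_constraints.mp hab with h | ⟨g, h⟩
      · exact ordSign_flatten_ofFn_of_lt w (hdisj w hw) h
          ((hmem w hw _ a).mpr (P.mem_group.mpr rfl)) ((hmem w hw _ b).mpr (P.mem_group.mpr rfl))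
      · have hm := P.within_mem g _ h
        rw [ordSign_flatten_ofFn w (hdisj w hw) ((hmem w hw g a).mpr (P.mem_group.mpr hm.1))
          ((hmem w hw g b).mpr (P.mem_group.mpr hm.2.1))]
        refine hcon g a b ?_ _ (hw g)
        rcases P.within_eq_empty_or_singleton g with h' | ⟨i, j, h'⟩
        · simp [h'] at h
        · rw [h', Finset.mem_singleton] at h
          rw [h', h]
  · intro g a ha b hb c hc d hd
    rw [rowMean_sections hne hD g (signFun a b * signFun c d) _ fun w hw => by
      rw [Pi.mul_apply, Pi.mul_apply, hsign g a ha b hb w hw, hsign g c hc d hd w hw]]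
    have h1 : ((3 * pairSum (Dg g) a b c d : ℤ) : ℝ) = (Dg g).length * pairCov a b c d := by
      exact_mod_cast (hbal g).pairSum_eq a ha b hb c hc d hd
    have h2 := rowMean_intCast (Dg g) fun r => ordSign a b r * ordSign c d r
    have h3 : (signFun a b * signFun c d : List (Fin m) → ℝ) =
        fun r => ((ordSign a b r * ordSign c d r : ℤ) : ℝ) := by
      ext r
      simp [signFun]
    rw [h3, h2, div_eq_div_iff (hlen g) three_ne_zero]
    change (pairSum (Dg g) a b c d : ℝ) * 3 = _
    push_cast at h1
    linarith
  · intro g h hgh a ha b hb c hc d hd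
    rw [rowMean_sections_mul hne hD hgh (signFun a b) (signFun c d) _ fun w hw => by
      rw [Pi.mul_apply, hsign g a ha b hb w hw, hsign h c hc d hd w hw],
      hmean g a ha b hb, hmean h c hc d hd]
  · intro g hg a ha b hb
    rw [hmean g a ha b hb]
    unfold signFun
    rw [rowMean_intCast, hcen g hg a ha b hb]
    simp

theorem IsConstructedCOD.hasProductMoments {P : MixedProblem m n} {D : List (List (Fin m))}
    (hD : P.IsConstructedCOD D) : P.HasProductMoments D := by
  obtain ⟨Dg, hun, hco, hperm⟩ := hD
  have hU : ∀ g, P.within g = ∅ →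
      Dg g ≠ [] ∧ IsPairBalanced (P.group g) (Dg g) ∧ IsCentered (P.group g) (Dg g) := by
    intro g hg
    rcases hun g hg with h | h
    · exact h.properties
    · exact ⟨h.1, h.isPairBalanced, h.isCentered⟩
  have hC : ∀ g i j, P.within g = {(i, j)} →
      Dg g ≠ [] ∧ IsPairBalanced (P.group g) (Dg g) ∧ ∀ r ∈ Dg g, ordSign i j r = 1 := by
    intro g i j hg
    have hm := P.within_mem g (i, j) (by simp [hg])
    rcases Nat.even_or_odd (P.group g).card with h | h
    · exact ((hco g i j hg).1 h).properties (P.mem_group.mpr hm.1) (P.mem_group.mpr hm.2.1) hm.2.2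
    · exact ((hco g i j hg).2 h).properties (P.mem_group.mpr hm.1) (P.mem_group.mpr hm.2.1) hm.2.2
  have hA : ∀ g, Dg g ≠ [] ∧ IsPairBalanced (P.group g) (Dg g) := by
    intro g
    rcases P.within_eq_empty_or_singleton g with h | ⟨i, j, h⟩
    · exact ⟨(hU g h).1, (hU g h).2.1⟩
    · exact ⟨(hC g i j h).1, (hC g i j h).2.1⟩
  exact P.hasProductMoments_of_groups (fun g => (hA g).1) (fun g => (hA g).2)
    (fun g h => (hU g h).2.2) (fun g i j h => (hC g i j h).2.2) hperm

end MixedProblem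

end OofA

theorem corollary1 {m n : ℕ} (P : OofA.MixedProblem m n) (D : List (List (Fin m)))
    (hD : P.IsConstructedCOD D) :
    (∀ r ∈ D, r ∈ P.feasible) ∧
      P.IsDOptimal (OofA.runProportion D) ∧ P.IsGOptimal (OofA.runProportion D) :=
  ⟨hD.hasProductMoments.feasible, hD.hasProductMoments.optimal⟩
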